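/- Let $\mathbb{T}^n=\mathbb{R}^n/\mathbb{Z}^n$, let $\mathbf v_1,\dots,\mathbf v_d\in\mathbb{R}^n$ be linearly independent, and let $\mathcal C=\mathbb{T}^n\times\{\xi : \mathbf v_1\cdot\xi=\dots=\mathbf v_d\cdot\xi=0\}\subset T^*\mathbb{T}^n$. Put $B_j=\mathbf v_j\cdot hD_x$ with $D_x=-i\partial_x$, and $\mathbf B^\beta=B_1^{\beta_1}\cdots B_d^{\beta_d}$. *Residual operators.* For $l\in\mathbb{R}$, $\Re^l$ is the set of families $R=(R_h)_{0<h<1}$ of bounded linear operators on $L^2(\mathbb{T}^n)$ such that for all multi-indices $\beta,\gamma\in\mathbb{N}^d$ the operators $h^{-|\beta+\gamma|+l}\,\mathbf B^\beta R_h\mathbf B^\gamma$ (defined on $C^\infty(\mathbb{T}^n)$, with distributional values) extend to operators on $L^2(\mathbb{T}^n)$ that are bounded uniformly as $h\downarrow 0$. Put $\Re=\bigcup_{l\in\mathbb{R}}\Re^l$. *Symbols and quantizations.* Let $S_{\mathrm{tot}}=[T^*\mathbb{T}^n\times[0,1)_h;\mathcal C\times\{h=0\}]$ be the real (inward-pointing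 spherical) blowup, with boundary defining functions $\rho_{\mathrm{ff}}$ and $\rho_{\mathrm{sf}}$ of its front face and side face, and let $S^{m,l}(S_{\mathrm{tot}})=\rho_{\mathrm{sf}}^{-m}\rho_{\mathrm{ff}}^{-l}C_c^\infty(S_{\mathrm{tot}})$ for $m,l\in\mathbb{R}$. Fix a smooth cutoff $\chi$ on $\mathbb{T}^n\times\mathbb{T}^n$ that equals $1$ near the diagonal and is supported in a neighborhood of the diagonal on which $x-y$ has a well-defined representative in $(-\frac12,\frac12)^n$. For $a\in S^{m,l}(S_{\mathrm{tot}})$ and $0<h<1$, let ${}^h\mathrm{Op_l}(a)$ and ${}^h\mathrm{Op_r}(a)$ be the operators with kernels $$(2\pi h)^{-n}\int e^{\frac ih(x-y)\cdot\xi}\chi(x,y)\,a(x,\xi;h)\,d\xi,\qquad (2\pi h)^{-n}\int e^{\frac ih(x-y)\cdot\xi}\chi(x,y)\,a(y,\xi;h)\,d\xi,$$ respectively, and let $\Psi_{2,h}(\mathcal C)=\Re+\bigcup_{m,l\in\mathbb{R}}{}^h\mathrm{Op_l}(S^{m,l}(S_{\mathrm{tot}}))$. **Proposition.** The residual operators form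 a two-sided ideal in $\Psi_{2,h}(\mathcal C)$: $\Re$ is closed under addition and under multiplication by complex scalars, it contains $0$ and is contained in $\Psi_{2,h}(\mathcal C)$, and $AR\in\Re$, $RA\in\Re$ for all $A\in\Psi_{2,h}(\mathcal C)$ and $R\in\Re$. More precisely, for all $m,l,l'\in\mathbb{R}$, all $a\in S^{m,l}(S_{\mathrm{tot}})$ and all $R\in\Re^{l'}$, $${}^h\mathrm{Op_r}(a)\,R\in\Re^{l+l'}\quad\text{and}\quad R\;{}^h\mathrm{Op_r}(a)\in\Re^{l+l'};$$ moreover $\Re^{l}\,\Re^{l'}\subset\Re^{l+l'}$ for all $l,l'\in\mathbb{R}$. -/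

import Mathlib

open MeasureTheory Filter Topology
open scoped ContDiff InnerProductSpace

noncomputable section

namespace SecondMicro

/-! ### The torus `ℝⁿ / ℤⁿ`, smooth functions and `L²` -/

/-- The torus `𝕋ⁿ = ℝⁿ / ℤⁿ`. -/
abbrev Torus (n : ℕ) : Type := UnitAddTorus (Fin n)

/-- The quotient map `ℝⁿ → 𝕋ⁿ`. -/
def proj {n : ℕ} (x : Fin n → ℝ) : Torus n := fun i => (x i : UnitAddCircle)

/-- Lebesgue measure on `𝕋ⁿ` (total mass `1`). -/
def torusMeasure (n : ℕ) : Measure (Torus n) :=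
  Measure.pi fun _ => AddCircle.haarAddCircle

instance (n : ℕ) : IsProbabilityMeasure (torusMeasure n) := by
  unfold torusMeasure; infer_instance

/-- The Hilbert space `L²(𝕋ⁿ)`. -/
abbrev L2 (n : ℕ) : Type := Lp ℂ 2 (torusMeasure n)

lemma proj_add {n : ℕ} (x y : Fin n → ℝ) : proj (x + y) = proj x + proj y := by
  ext i; simp [proj]

lemma isOpenQuotientMap_proj (n : ℕ) : IsOpenQuotientMap (proj (n := n)) := by
  have h : ∀ _ : Fin n, IsOpenQuotientMap (fun t : ℝ => (t : UnitAddCircle)) := fun _ =>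
    QuotientAddGroup.isOpenQuotientMap_mk
  exact IsOpenQuotientMap.piMap h

/-- The space `C^∞(𝕋ⁿ)`: functions whose lift to `ℝⁿ` is smooth. -/
def SmoothFn (n : ℕ) : Submodule ℂ (Torus n → ℂ) where
  carrier := {φ | ContDiff ℝ ∞ fun x : Fin n → ℝ => φ (proj x)}
  zero_mem' := by
    change ContDiff ℝ ∞ fun _ : Fin n → ℝ => (0 : ℂ)
    exact contDiff_const
  add_mem' := by
    intro φ ψ hφ hψ
    have h1 : ContDiff ℝ ∞ fun x : Fin n → ℝ => φ (proj x) := hφ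
    have h2 : ContDiff ℝ ∞ fun x : Fin n → ℝ => ψ (proj x) := hψ
    exact h1.add h2
  smul_mem' := by
    intro c φ hφ
    have h1 : ContDiff ℝ ∞ fun x : Fin n → ℝ => φ (proj x) := hφ
    exact h1.const_smul c

lemma contDiff_lift {n : ℕ} (φ : SmoothFn n) : ContDiff ℝ ∞ fun x : Fin n → ℝ => φ.1 (proj x) :=
  φ.2

lemma continuous_smoothFn {n : ℕ} (φ : SmoothFn n) : Continuous φ.1 :=
  (isOpenQuotientMap_proj n).isQuotientMap.continuous_iff.2 (contDiff_lift φ).continuous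

/-- The inclusion `C^∞(𝕋ⁿ) → L²(𝕋ⁿ)`. -/
def toL2 {n : ℕ} (φ : SmoothFn n) : L2 n :=
  ContinuousMap.toLp 2 (torusMeasure n) ℂ ⟨φ.1, continuous_smoothFn φ⟩

/-- The derivative of `φ` at `X ∈ 𝕋ⁿ` in the direction `w ∈ ℝⁿ`, i.e. `(w · ∂ₓ) φ (X)`. -/
def dirDeriv {n : ℕ} (w : Fin n → ℝ) (φ : Torus n → ℂ) (X : Torus n) : ℂ :=
  deriv (fun t : ℝ => φ (X + proj (t • w))) 0

lemma dirDeriv_proj {n : ℕ} (w : Fin n → ℝ) (φ : SmoothFn n) (x : Fin n → ℝ) :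
    HasDerivAt (fun t : ℝ => φ.1 (proj x + proj (t • w)))
      (fderiv ℝ (fun y : Fin n → ℝ => φ.1 (proj y)) x w) 0 := by
  have h1 : HasDerivAt (fun t : ℝ => x + t • w) w 0 := by
    simpa using ((hasDerivAt_id (0 : ℝ)).smul_const w).const_add x
  have hφ : Differentiable ℝ (fun y : Fin n → ℝ => φ.1 (proj y)) :=
    (contDiff_lift φ).differentiable (by simp)
  have h2 := (hφ (x + (0 : ℝ) • w)).hasFDerivAt.comp_hasDerivAt (0 : ℝ) h1
  simp only [zero_smul, add_zero] at h2
  refine h2.congr_of_eventuallyEq (Eventually.of_forall fun t => ?_)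
  simp [proj_add]

/-- The first order operator `w · h Dₓ` on `C^∞(𝕋ⁿ)`, where `D = -i ∂`. -/
def hD {n : ℕ} (h : ℝ) (w : Fin n → ℝ) : Module.End ℂ (SmoothFn n) where
  toFun φ := ⟨fun X => -Complex.I * h * dirDeriv w φ.1 X, by
    have : (fun x : Fin n → ℝ => -Complex.I * h * dirDeriv w φ.1 (proj x)) =
        fun x => -Complex.I * h * fderiv ℝ (fun y : Fin n → ℝ => φ.1 (proj y)) x w := by
      funext x
      rw [dirDeriv, (dirDeriv_proj w φ x).deriv]
    change ContDiff ℝ ∞ fun x : Fin n → ℝ => -Complex.I * h * dirDeriv w φ.1 (proj x)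
    rw [this]
    have hφ : ContDiff ℝ ∞ (fun y : Fin n → ℝ => φ.1 (proj y)) := φ.2
    exact contDiff_const.mul ((hφ.fderiv_right (m := ∞) (by simp)).clm_apply contDiff_const)⟩
  map_add' := by
    intro φ ψ
    ext X
    obtain ⟨x, rfl⟩ := (isOpenQuotientMap_proj n).surjective X
    have := ((dirDeriv_proj w φ x).add (dirDeriv_proj w ψ x)).deriv
    have e : dirDeriv w (φ + ψ).1 (proj x) =
        dirDeriv w φ.1 (proj x) + dirDeriv w ψ.1 (proj x) := by
      rw [dirDeriv, dirDeriv, dirDeriv, (dirDeriv_proj w φ x).deriv, (dirDeriv_proj w ψ x).deriv,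
        ← this]
      rfl
    change -Complex.I * h * dirDeriv w (φ + ψ).1 (proj x) =
      -Complex.I * h * dirDeriv w φ.1 (proj x) + -Complex.I * h * dirDeriv w ψ.1 (proj x)
    rw [e, mul_add]
  map_smul' := by
    intro c φ
    ext X
    obtain ⟨x, rfl⟩ := (isOpenQuotientMap_proj n).surjective X
    have := ((dirDeriv_proj w φ x).const_mul c).deriv
    have e : dirDeriv w (c • φ).1 (proj x) = c * dirDeriv w φ.1 (proj x) := by
      rw [dirDeriv, dirDeriv, (dirDeriv_proj w φ x).deriv, ← this]
      rfl
    change -Complex.I * h * dirDeriv w (c • φ).1 (proj x) =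
      c * (-Complex.I * h * dirDeriv w φ.1 (proj x))
    rw [e]; ring

/-! ### Families of operators and residual operators

The linear coisotropic is `𝒞 = 𝕋ⁿ × {ξ | v₁·ξ = ⋯ = v_d·ξ = 0}` for linearly independent
`v₁, …, v_d ∈ ℝⁿ`. -/

/-- The range `(0,1)` of the semiclassical parameter. -/
abbrev HParam : Type := Set.Ioo (0 : ℝ) 1

/-- `h`-dependent families of bounded linear operators on `L²(𝕋ⁿ)`. Sums, scalar multiples and
products (compositions) of families are taken separately for each `h`. -/
abbrev OpFamily (n : ℕ) : Type := HParam → (L2 n →L[ℂ] L2 n)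

/-- `𝐁^β = B₁^{β₁} ⋯ B_d^{β_d}` on `C^∞(𝕋ⁿ)`, with `B_j = v_j · h Dₓ`. -/
def charMonomial {n d : ℕ} (v : Fin d → Fin n → ℝ) (h : ℝ) (β : Fin d → ℕ) :
    Module.End ℂ (SmoothFn n) :=
  (List.ofFn fun j => hD h (v j) ^ β j).prod

/-- `g = 𝐁^β f` in the sense of distributions, for `f, g ∈ L²(𝕋ⁿ)`
(the operators `B_j` commute and are formally self-adjoint). -/
def IsWeakCharMonomial {n d : ℕ} (v : Fin d → Fin n → ℝ) (h : ℝ) (β : Fin d → ℕ)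
    (f g : L2 n) : Prop :=
  ∀ ψ : SmoothFn n, ⟪toL2 ψ, g⟫_ℂ = ⟪toL2 (charMonomial v h β ψ), f⟫_ℂ

/-- The residual space `ℜ^l`: for all multi-indices `β, γ` the operators
`h^{-|β+γ|+l} 𝐁^β R 𝐁^γ`, defined on `C^∞(𝕋ⁿ)` with values in distributions, extend to operators
`L²(𝕋ⁿ) → L²(𝕋ⁿ)` that are bounded uniformly as `h ↓ 0`. -/
def Residual {n d : ℕ} (v : Fin d → Fin n → ℝ) (l : ℝ) : Set (OpFamily n) :=
  {R | ∀ β γ : Fin d → ℕ, ∃ C h₀ : ℝ, 0 < h₀ ∧ ∀ h : HParam, (h : ℝ) < h₀ →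
    ∃ T : L2 n →L[ℂ] L2 n,
      (∀ φ : SmoothFn n, IsWeakCharMonomial v h β (R h (toL2 (charMonomial v h γ φ)))
        (T (toL2 φ))) ∧
      (h : ℝ) ^ (-((∑ j, (β j + γ j) : ℕ) : ℝ) + l) * ‖T‖ ≤ C}

/-- `ℜ = ⋃_l ℜ^l`. -/
def ResidualAll {n d : ℕ} (v : Fin d → Fin n → ℝ) : Set (OpFamily n) :=
  ⋃ l : ℝ, Residual v l

/-! ### The blown-up space `S_tot = [T*𝕋ⁿ × [0,1) ; 𝒞 × {0}]` and total symbols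

The conormal directions to `𝒞 × {0}` are `(v₁·ξ, …, v_d·ξ, h)`; the blowup introduces polar
coordinates `(v₁·ξ, …, v_d·ξ, h) = r (θ, σ)` with `r ≥ 0` and `(θ, σ)` in the closed half sphere
`{|θ|² + σ² = 1, σ ≥ 0}`. -/

/-- The space with coordinates `(X, ξ, r, θ, σ)` in which `S_tot` is embedded. -/
abbrev Ambient (n d : ℕ) : Type :=
  Torus n × (Fin n → ℝ) × ℝ × (Fin d → ℝ) × ℝ

/-- `S_tot` as an embedded submanifold with corners. The blowdown map is
`(X, ξ, r, θ, σ) ↦ (X, ξ, h = r σ)`, the front face is `{r = 0}` and the side face is `{σ = 0}`,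
with boundary defining functions `ρ_ff = r` and `ρ_sf = σ`. -/
def STot {n d : ℕ} (v : Fin d → Fin n → ℝ) : Set (Ambient n d) :=
  {(_, ξ, r, θ, σ) | 0 ≤ r ∧ 0 ≤ σ ∧ ∑ j, θ j ^ 2 + σ ^ 2 = 1 ∧
    (∀ j, v j ⬝ᵥ ξ = r * θ j) ∧ r * σ < 1}

/-- `G` restricts to an element of `C_c^∞(S_tot)`: its restriction to `S_tot` has compact support,
and is smooth, as the restriction of a smooth function on the ambient manifold. (Any compactly
supported function on `S_tot` that is smooth up to the boundary faces extends in this way.) -/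
structure IsSmoothCompact {n d : ℕ} (v : Fin d → Fin n → ℝ) (G : Ambient n d → ℂ) : Prop where
  smooth : ContDiff ℝ ∞ fun q : (Fin n → ℝ) × (Fin n → ℝ) × ℝ × (Fin d → ℝ) × ℝ =>
    G (proj q.1, q.2)
  compact_support : ∃ K : Set (Ambient n d), IsCompact K ∧ K ⊆ STot v ∧
    ∀ p ∈ STot v, p ∉ K → G p = 0

/-- The symbol class `S^{m,l}(S_tot) = ρ_sf^{-m} ρ_ff^{-l} C_c^∞(S_tot)`, whose elements are
regarded as functions of `(X, ξ, h) ∈ T*𝕋ⁿ × (0,1)` through the blowdown map. -/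
structure TotalSymbol {n d : ℕ} (v : Fin d → Fin n → ℝ) (m l : ℝ) where
  toFun : Torus n → (Fin n → ℝ) → HParam → ℂ
  isSymbol : ∃ G : Ambient n d → ℂ, IsSmoothCompact v G ∧
    ∀ (X : Torus n) (ξ : Fin n → ℝ) (h : HParam) (r : ℝ) (θ : Fin d → ℝ) (σ : ℝ),
      (X, ξ, r, θ, σ) ∈ STot v → r * σ = h →
      toFun X ξ h = ((σ ^ (-m) * r ^ (-l) : ℝ) : ℂ) * G (X, ξ, r, θ, σ)

instance {n d : ℕ} (v : Fin d → Fin n → ℝ) (m l : ℝ) :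
    CoeFun (TotalSymbol v m l) (fun _ => Torus n → (Fin n → ℝ) → HParam → ℂ) :=
  ⟨TotalSymbol.toFun⟩

/-! ### Quantization -/

/-- A cutoff near the diagonal: a smooth function `χ` on `𝕋ⁿ × 𝕋ⁿ`, equal to `1` near the
diagonal, and supported where all `|x_i - y_i| < 1/2`, so that `x - y ∈ ℝⁿ` makes sense. -/
structure Cutoff (n : ℕ) where
  toFun : Torus n → Torus n → ℝ
  smooth : ContDiff ℝ ∞ fun q : (Fin n → ℝ) × (Fin n → ℝ) => toFun (proj q.1) (proj q.2)
  support : ∀ p ∈ tsupport (Function.uncurry toFun), ∀ i, ‖p.1 i - p.2 i‖ < 1 / 2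
  eq_one : ∀ᶠ p in 𝓝ˢ (Set.diagonal (Torus n)), Function.uncurry toFun p = 1

instance (n : ℕ) : CoeFun (Cutoff n) (fun _ => Torus n → Torus n → ℝ) := ⟨Cutoff.toFun⟩

/-- The representative in `[-1/2, 1/2)ⁿ` of a point of `𝕋ⁿ`. -/
def rep {n : ℕ} (X : Torus n) (i : Fin n) : ℝ :=
  (AddCircle.equivIco (1 : ℝ) (-(1 / 2)) (X i) : ℝ)

/-- `(2πh)^{-n} ∫ e^{(i/h)(x-y)·ξ} χ(x,y) s(ξ) dξ`. -/
def oscKernel {n : ℕ} (χ : Cutoff n) (h : ℝ) (s : (Fin n → ℝ) → ℂ) (X Y : Torus n) : ℂ :=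
  (((2 * Real.pi * h) ^ n)⁻¹ : ℝ) *
    ∫ ξ : Fin n → ℝ, Complex.exp (Complex.I / h * (rep (X - Y) ⬝ᵥ ξ : ℝ)) * χ X Y * s ξ

/-- Kernel of the left quantization of `a`. -/
def kernelL {n d : ℕ} {v : Fin d → Fin n → ℝ} {m l : ℝ} (χ : Cutoff n)
    (a : TotalSymbol v m l) (h : HParam) (p : Torus n × Torus n) : ℂ :=
  oscKernel χ h (fun ξ => a p.1 ξ h) p.1 p.2

/-- Kernel of the right quantization of `a`. -/
def kernelR {n d : ℕ} {v : Fin d → Fin n → ℝ} {m l : ℝ} (χ : Cutoff n)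
    (a : TotalSymbol v m l) (h : HParam) (p : Torus n × Torus n) : ℂ :=
  oscKernel χ h (fun ξ => a p.2 ξ h) p.1 p.2

lemma continuousAt_rep_coord {x : UnitAddCircle} (hx : ‖x‖ < 1 / 2) :
    ContinuousAt (fun y => (AddCircle.equivIco (1 : ℝ) (-(1 / 2)) y : ℝ)) x := by
  have hne : x ≠ ((-(1 / 2) : ℝ) : UnitAddCircle) := by
    intro h
    rw [h, AddCircle.norm_eq] at hx
    norm_num at hx
  exact continuous_subtype_val.continuousAt.comp
    (AddCircle.continuousAt_equivIco (1 : ℝ) (-(1 / 2)) hne)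

lemma Cutoff.continuous {n : ℕ} (χ : Cutoff n) : Continuous (Function.uncurry χ.toFun) :=
  ((isOpenQuotientMap_proj n).prodMap (isOpenQuotientMap_proj n)).isQuotientMap.continuous_iff.2
    χ.smooth.continuous

lemma continuous_oscKernel {n : ℕ} (χ : Cutoff n) (h : ℝ)
    (s : Torus n × Torus n → (Fin n → ℝ) → ℂ) (hs : Continuous (Function.uncurry s)) (M : ℝ)
    (hM : ∀ p ξ, s p ξ ≠ 0 → ‖ξ‖ ≤ M) :
    Continuous fun p : Torus n × Torus n => oscKernel χ h (s p) p.1 p.2 := by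
  unfold oscKernel
  refine continuous_const.mul ?_
  set f : Torus n × Torus n → (Fin n → ℝ) → ℂ := fun p ξ =>
    Complex.exp (Complex.I / h * (rep (p.1 - p.2) ⬝ᵥ ξ : ℝ)) * χ p.1 p.2 * s p ξ with hf
  have hcont : Continuous (Function.uncurry f) := by
    rw [continuous_iff_continuousAt]
    rintro ⟨p, ξ⟩
    by_cases hp : p ∈ tsupport (Function.uncurry χ.toFun)
    · have h2 : ContinuousAt (fun q : (Torus n × Torus n) × (Fin n → ℝ) =>
          rep (q.1.1 - q.1.2) ⬝ᵥ q.2) (p, ξ) := by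
        unfold dotProduct
        refine tendsto_finsetSum _ fun i _ => ?_
        have h0 : Continuous fun q : (Torus n × Torus n) × (Fin n → ℝ) => q.1.1 i - q.1.2 i :=
          (((continuous_apply i).comp continuous_fst).sub
            ((continuous_apply i).comp continuous_snd)).comp continuous_fst
        have h1 : ContinuousAt (fun q : (Torus n × Torus n) × (Fin n → ℝ) =>
            rep (q.1.1 - q.1.2) i) (p, ξ) :=
          ContinuousAt.comp
            (g := fun y : UnitAddCircle => (AddCircle.equivIco (1 : ℝ) (-(1 / 2)) y : ℝ))
            (f := fun q : (Torus n × Torus n) × (Fin n → ℝ) => q.1.1 i - q.1.2 i)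
            (continuousAt_rep_coord (χ.support p hp i)) h0.continuousAt
        exact h1.mul ((continuous_apply i).comp continuous_snd).continuousAt
      have h3 : ContinuousAt (fun q : (Torus n × Torus n) × (Fin n → ℝ) =>
          ((χ q.1.1 q.1.2 : ℝ) : ℂ)) (p, ξ) :=
        (Complex.continuous_ofReal.comp (χ.continuous.comp continuous_fst)).continuousAt
      have h4 : ContinuousAt (fun q : (Torus n × Torus n) × (Fin n → ℝ) =>
          Complex.exp (Complex.I / h * (rep (q.1.1 - q.1.2) ⬝ᵥ q.2 : ℝ))) (p, ξ) :=
        Complex.continuous_exp.continuousAt.comp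
          (continuousAt_const.mul (Complex.continuous_ofReal.continuousAt.comp h2))
      exact (h4.mul h3).mul hs.continuousAt
    · have h1 : ∀ᶠ q in 𝓝 p, Function.uncurry χ.toFun q = 0 :=
        notMem_tsupport_iff_eventuallyEq.1 hp
      have h2 : ∀ᶠ q in 𝓝 (p, ξ), Function.uncurry f q = 0 := by
        filter_upwards [continuous_fst.continuousAt.eventually h1] with q hq
        have hq' : χ q.1.1 q.1.2 = 0 := hq
        simp [f, Function.uncurry, hq']
      exact (continuousAt_const (y := (0 : ℂ))).congr (h2.mono fun q hq => hq.symm)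
  have hint : ∀ p, ∫ ξ, f p ξ = ∫ ξ in Metric.closedBall 0 M, f p ξ := by
    intro p
    refine (setIntegral_eq_integral_of_forall_compl_eq_zero fun ξ hξ => ?_).symm
    have : s p ξ = 0 := by
      by_contra hne
      exact hξ (by simpa using hM p ξ hne)
    simp [f, this]
  exact (continuous_parametric_integral_of_continuous hcont
    (isCompact_closedBall 0 M)).congr fun p => (hint p).symm

section Continuity

variable {n d : ℕ} {v : Fin d → Fin n → ℝ} {m l : ℝ}

/-- The polar radius `r = |(v₁·ξ, …, v_d·ξ, h)|`. -/
def radius (v : Fin d → Fin n → ℝ) (ξ : Fin n → ℝ) (h : ℝ) : ℝ :=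
  √(∑ j, (v j ⬝ᵥ ξ) ^ 2 + h ^ 2)

lemma radius_pos (ξ : Fin n → ℝ) (h : HParam) : 0 < radius v ξ h := by
  have h0 : (0 : ℝ) < h := h.2.1
  unfold radius
  positivity

/-- Over `h > 0` every point of `T*𝕋ⁿ × (0,1)` lifts to `S_tot`. -/
lemma lift_mem_STot (X : Torus n) (ξ : Fin n → ℝ) (h : HParam) :
    (X, ξ, radius v ξ h, (fun j => (v j ⬝ᵥ ξ) / radius v ξ h), (h : ℝ) / radius v ξ h) ∈
      STot v := by
  have hr := radius_pos (v := v) ξ h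
  have h0 : (0 : ℝ) < h := h.2.1
  have hsq : radius v ξ h ^ 2 = ∑ j, (v j ⬝ᵥ ξ) ^ 2 + (h : ℝ) ^ 2 := by
    unfold radius
    exact Real.sq_sqrt (by positivity)
  refine ⟨hr.le, by positivity, ?_, fun j => ?_, ?_⟩
  · simp_rw [div_pow]
    rw [← Finset.sum_div, ← add_div, ← hsq, div_self (by positivity)]
  · field_simp
  · rw [mul_div_cancel₀ _ hr.ne']
    exact h.2.2

lemma TotalSymbol.continuous (a : TotalSymbol v m l) (h : HParam) :
    Continuous fun q : Torus n × (Fin n → ℝ) => a q.1 q.2 h := by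
  obtain ⟨G, hG, ha⟩ := a.isSymbol
  have hq : Topology.IsQuotientMap (Prod.map (proj (n := n)) (id : (Fin n → ℝ) → _)) :=
    ((isOpenQuotientMap_proj n).prodMap IsOpenQuotientMap.id).isQuotientMap
  refine hq.continuous_iff.2 ?_
  have h0 : (0 : ℝ) < h := h.2.1
  have hr : Continuous fun q : (Fin n → ℝ) × (Fin n → ℝ) => radius v q.2 h := by
    unfold radius dotProduct
    fun_prop
  have hrp : ∀ q : (Fin n → ℝ) × (Fin n → ℝ), radius v q.2 h ≠ 0 := fun q =>
    (radius_pos q.2 h).ne'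
  have key : (fun q : Torus n × (Fin n → ℝ) => a q.1 q.2 h) ∘ Prod.map proj id =
      fun q : (Fin n → ℝ) × (Fin n → ℝ) =>
        (((h / radius v q.2 h) ^ (-m) * radius v q.2 h ^ (-l) : ℝ) : ℂ) *
          G (proj q.1, q.2, radius v q.2 h, (fun j => (v j ⬝ᵥ q.2) / radius v q.2 h),
            h / radius v q.2 h) := by
    funext q
    exact ha _ _ h _ _ _ (lift_mem_STot (proj q.1) q.2 h) (mul_div_cancel₀ _ (hrp q))
  rw [key]
  have hσ : Continuous fun q : (Fin n → ℝ) × (Fin n → ℝ) => (h : ℝ) / radius v q.2 h :=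
    continuous_const.div hr hrp
  refine Continuous.mul (Complex.continuous_ofReal.comp (Continuous.mul ?_ ?_)) ?_
  · exact hσ.rpow_const fun q => Or.inl (div_ne_zero h0.ne' (hrp q))
  · exact hr.rpow_const fun q => Or.inl (hrp q)
  · refine hG.smooth.continuous.comp (g := fun q : (Fin n → ℝ) × (Fin n → ℝ) × ℝ ×
      (Fin d → ℝ) × ℝ => G (proj q.1, q.2))
      (f := fun q : (Fin n → ℝ) × (Fin n → ℝ) => (q.1, q.2, radius v q.2 h,
        (fun j => (v j ⬝ᵥ q.2) / radius v q.2 h), (h : ℝ) / radius v q.2 h)) ?_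
    have hj : Continuous fun q : (Fin n → ℝ) × (Fin n → ℝ) =>
        (fun j => (v j ⬝ᵥ q.2) / radius v q.2 h) := by
      refine continuous_pi fun j => Continuous.div ?_ hr hrp
      unfold dotProduct
      fun_prop
    exact continuous_fst.prodMk (continuous_snd.prodMk (hr.prodMk (hj.prodMk hσ)))

lemma TotalSymbol.bounded_support (a : TotalSymbol v m l) (h : HParam) :
    ∃ M : ℝ, ∀ X ξ, a X ξ h ≠ 0 → ‖ξ‖ ≤ M := by
  obtain ⟨G, hG, ha⟩ := a.isSymbol
  obtain ⟨K, hK, -, hK0⟩ := hG.compact_support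
  obtain ⟨M, hM⟩ := (hK.image (continuous_fst.comp continuous_snd)).isBounded.exists_norm_le
  refine ⟨M, fun X ξ hne => hM ξ ?_⟩
  have hmem := lift_mem_STot (v := v) X ξ h
  rw [ha _ _ h _ _ _ hmem (mul_div_cancel₀ _ (radius_pos ξ h).ne')] at hne
  by_contra hnot
  refine hne ?_
  rw [hK0 _ hmem fun hmK => hnot ⟨_, hmK, rfl⟩, mul_zero]

lemma continuous_kernelL (χ : Cutoff n) (a : TotalSymbol v m l) (h : HParam) :
    Continuous (kernelL χ a h) := by
  obtain ⟨M, hM⟩ := a.bounded_support h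
  exact continuous_oscKernel χ h (fun p ξ => a p.1 ξ h)
    ((a.continuous h).comp ((continuous_fst.comp continuous_fst).prodMk continuous_snd)) M
    fun p ξ => hM _ ξ

lemma continuous_kernelR (χ : Cutoff n) (a : TotalSymbol v m l) (h : HParam) :
    Continuous (kernelR χ a h) := by
  obtain ⟨M, hM⟩ := a.bounded_support h
  exact continuous_oscKernel χ h (fun p ξ => a p.2 ξ h)
    ((a.continuous h).comp ((continuous_snd.comp continuous_fst).prodMk continuous_snd)) M
    fun p ξ => hM _ ξ

end Continuity

lemma integrable_mul_L2 {n : ℕ} (k : C(Torus n, ℂ)) (u : L2 n) :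
    Integrable (fun Y => k Y * u Y) (torusMeasure n) := by
  have hu : Integrable u (torusMeasure n) := (Lp.memLp u).integrable (by norm_num)
  exact hu.bdd_mul k.continuous.aestronglyMeasurable (Eventually.of_forall k.norm_coe_le_norm)

lemma continuous_integral_kernel {n : ℕ} (K : C(Torus n × Torus n, ℂ)) (u : L2 n) :
    Continuous fun X => ∫ Y, K (X, Y) * u Y ∂torusMeasure n := by
  have hu : Integrable u (torusMeasure n) := (Lp.memLp u).integrable (by norm_num)
  refine continuous_of_dominated (bound := fun Y => ‖K‖ * ‖u Y‖) (fun X => ?_) (fun X => ?_)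
    (hu.norm.const_mul _) ?_
  · exact (integrable_mul_L2 (K.curry X) u).aestronglyMeasurable
  · refine Eventually.of_forall fun Y => ?_
    rw [norm_mul]
    exact mul_le_mul_of_nonneg_right (K.norm_coe_le_norm _) (norm_nonneg _)
  · exact Eventually.of_forall fun Y => by fun_prop

/-- The operator on `L²(𝕋ⁿ)` with continuous kernel `K`: `(A u)(x) = ∫ K(x,y) u(y) dy`. -/
def integralOp {n : ℕ} (K : C(Torus n × Torus n, ℂ)) : L2 n →L[ℂ] L2 n :=
  (ContinuousMap.toLp 2 (torusMeasure n) ℂ).comp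
    (LinearMap.mkContinuous (
      { toFun := fun u => (⟨fun X => ∫ Y, K (X, Y) * u Y ∂torusMeasure n,
          continuous_integral_kernel K u⟩ : C(Torus n, ℂ))
        map_add' := by
          intro u w
          ext X
          have h1 := integrable_mul_L2 (K.curry X) u
          have h2 := integrable_mul_L2 (K.curry X) w
          refine Eq.trans (integral_congr_ae ?_) (integral_add h1 h2)
          filter_upwards [Lp.coeFn_add u w] with Y hY
          rw [hY]
          exact mul_add _ _ _
        map_smul' := by
          intro c u
          ext X
          change ∫ Y, K (X, Y) * (c • u : L2 n) Y ∂torusMeasure n =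
            c * ∫ Y, K (X, Y) * u Y ∂torusMeasure n
          rw [← integral_const_mul]
          refine integral_congr_ae ?_
          filter_upwards [Lp.coeFn_smul c u] with Y hY
          rw [hY]
          simp only [Pi.smul_apply, smul_eq_mul]
          ring } : L2 n →ₗ[ℂ] C(Torus n, ℂ))
      ‖K‖ (by
        intro u
        refine (ContinuousMap.norm_le _ (by positivity)).2 fun X => ?_
        have hu : MemLp u 2 (torusMeasure n) := Lp.memLp u
        have h1 : ∫ Y, ‖u Y‖ ∂torusMeasure n ≤ ‖u‖ := by
          have h2 : eLpNorm u 1 (torusMeasure n) ≤ eLpNorm u 2 (torusMeasure n) :=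
            eLpNorm_le_eLpNorm_of_exponent_le (by norm_num) hu.1
          rw [integral_norm_eq_lintegral_enorm hu.1, ← eLpNorm_one_eq_lintegral_enorm,
            Lp.norm_def]
          exact ENNReal.toReal_mono hu.2.ne h2
        refine (norm_integral_le_of_norm_le (g := fun Y => ‖K‖ * ‖u Y‖)
          ((hu.integrable (by norm_num)).norm.const_mul _)
          (Eventually.of_forall fun Y => ?_)).trans ?_
        · rw [norm_mul]
          exact mul_le_mul_of_nonneg_right (K.norm_coe_le_norm _) (norm_nonneg _)
        · rw [integral_const_mul]
          exact mul_le_mul_of_nonneg_left h1 (norm_nonneg _)))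

/-- The left quantization `ʰOp_l(a)`. -/
def opL {n d : ℕ} {v : Fin d → Fin n → ℝ} {m l : ℝ} (χ : Cutoff n) (a : TotalSymbol v m l) :
    OpFamily n :=
  fun h => integralOp ⟨kernelL χ a h, continuous_kernelL χ a h⟩

/-- The right quantization `ʰOp_r(a)`. -/
def opR {n d : ℕ} {v : Fin d → Fin n → ℝ} {m l : ℝ} (χ : Cutoff n) (a : TotalSymbol v m l) :
    OpFamily n :=
  fun h => integralOp ⟨kernelR χ a h, continuous_kernelR χ a h⟩

/-- The second microlocal calculus `Ψ_{2,h}(𝒞) = ℜ + ⋃_{m,l} ʰOp_l(S^{m,l}(S_tot))`. -/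
def Psi {n d : ℕ} (v : Fin d → Fin n → ℝ) (χ : Cutoff n) : Set (OpFamily n) :=
  {A | ∃ R ∈ ResidualAll v, ∃ (m l : ℝ) (a : TotalSymbol v m l), A = R + opL χ a}

end SecondMicro

end

/-!
The proof takes place on the Fourier side. An operator on `L²(𝕋ⁿ)` is described by its matrix
`T_{pq} = ⟨e_p, T e_q⟩` in the basis of characters, and `B_j` acts on `e_p` as multiplication by
`h vⱼ · P`, where `P = 2πp` is the frequency. Write `Λ(P) = √(1 + ∑ⱼ (vⱼ · P)²)`.

* `mem_residual_iff`: `R ∈ ℜ^l` exactly when, for all `β, γ`, the matrices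
  `(v · P)^β R_{pq} (v · Q)^γ` define bounded operators of norm `O(h^{-l})`; the powers of `h` in
  the definition cancel those in `B_j`. So residual families are the ones that remain of size
  `h^{-l}` when any powers of `Λ` are applied on either side.
* `hasOrder_opR`, `hasOrder_opL`: the quantization `A` of a symbol in `S^{m,l}` satisfies
  `|A_{pq}| ≤ C_s h^{-l} (1 + |P - Q|)^{-s} Λ(P)^{m-l}` for all `s`. By Fubini `A_{pq}` is an
  integral over `ξ` of oscillatory integrals over `𝕋ⁿ × 𝕋ⁿ`, and integration by parts in the space
  variables alone (`oscIntegral_decay`) makes these decay rapidly in `P - Q` and in `ξ/h - P`.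
  The weight `σ^{-m} r^{-l}` of the symbol equals `h^{-l} Λ(ξ/h)^{m-l}`, and Peetre's inequality
  (`exists_radius_rpow_le`) replaces `ξ/h` by `P`. The behaviour of the symbol under
  differentiation in `ξ` plays no role.
* By Schur's test (`exists_operator_of_entry_le`) and Peetre's inequality, `(v · P)^β A Λ^{-2N}` and
  `Λ^{-2N} A (v · Q)^γ` are bounded by `O(h^{-l})` for large `N`. Since `Λ^{2N}` is a polynomial in
  the `vⱼ · P`, the families `Λ^{2N} R (v · Q)^γ` and `(v · P)^β R Λ^{2N}` are bounded by
  `O(h^{-l'})` if `R ∈ ℜ^{l'}`. Inserting `Λ^{-2N} Λ^{2N}` between the factors of `A R` and of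
  `R A` (`HasOrder.mul_residual`, `HasOrder.residual_mul`) shows that both lie in `ℜ^{l+l'}`, with
  no dependence on `m`.
-/

noncomputable section

namespace SecondMicro

variable {n d : ℕ}

/-! ### Translation flows and integration by parts -/

/-- A measure-preserving flow leaves integrals invariant, so the derivative of a function along
the flow has integral zero. Every integration by parts below is an instance of this. -/
theorem integral_eq_zero_of_flow {Ω : Type*} [MeasurableSpace Ω] {μ : Measure Ω}
    [IsFiniteMeasure μ] {τ : ℝ → Ω → Ω} (hτ : ∀ t, MeasurePreserving (τ t) μ μ)
    (h0 : ∀ z, τ 0 z = z) (hadd : ∀ s t z, τ (s + t) z = τ s (τ t z)) {F F' : Ω → ℂ}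
    (hF : AEStronglyMeasurable F μ) (hF' : AEStronglyMeasurable F' μ) {C C' : ℝ}
    (hC : ∀ z, ‖F z‖ ≤ C) (hC' : ∀ z, ‖F' z‖ ≤ C')
    (hd : ∀ z, HasDerivAt (fun s => F (τ s z)) (F' z) 0) :
    ∫ z, F' z ∂μ = 0 := by
  have hd' : ∀ z t, HasDerivAt (fun s => F (τ s z)) (F' (τ t z)) t := fun z t => by
    have h1 := HasDerivAt.comp_sub_const t t (by simpa using hd (τ t z))
    simpa only [← hadd, sub_add_cancel] using h1
  have key := (hasDerivAt_integral_of_dominated_loc_of_deriv_le (μ := μ) (x₀ := (0 : ℝ))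
    (s := Set.univ) (F := fun t z => F (τ t z)) (F' := fun t z => F' (τ t z))
    (bound := fun _ => C') univ_mem
    (Eventually.of_forall fun t => hF.comp_measurePreserving (hτ t))
    (.of_bound (hF.comp_measurePreserving (hτ 0)) C (Eventually.of_forall fun z => hC _))
    (hF'.comp_measurePreserving (hτ 0))
    (Eventually.of_forall fun z t _ => hC' _) (integrable_const _)
    (Eventually.of_forall fun z t _ => hd' z t)).2
  have hconst : (fun t => ∫ z, F (τ t z) ∂μ) = fun _ => ∫ z, F z ∂μ := by
    funext t
    conv_rhs => rw [← (hτ t).map_eq]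
    exact (integral_map (hτ t).measurable.aemeasurable (by rwa [(hτ t).map_eq])).symm
  rw [hconst] at key
  simpa [h0] using key.unique (hasDerivAt_const (0 : ℝ) _)

instance (n : ℕ) : (torusMeasure n).IsAddRightInvariant := by
  unfold torusMeasure; infer_instance

lemma proj_zero : proj (0 : Fin n → ℝ) = 0 := by
  ext i; simp [proj]

/-! ### Fourier basis -/

/-- The frequency vector `2πp ∈ ℝⁿ` of the character of `𝕋ⁿ` with index `p ∈ ℤⁿ`. -/
def freq (p : Fin n → ℤ) (i : Fin n) : ℝ := 2 * Real.pi * p i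

lemma mFourier_proj (p : Fin n → ℤ) (x : Fin n → ℝ) :
    UnitAddTorus.mFourier p (proj x) = Complex.exp (Complex.I * (freq p ⬝ᵥ x : ℝ)) := by
  simp only [UnitAddTorus.mFourier, ContinuousMap.coe_mk, proj, fourier_coe_apply, dotProduct,
    freq]
  rw [← Complex.exp_sum]
  congr 1
  push_cast
  rw [Finset.mul_sum]
  exact Finset.sum_congr rfl fun i _ => by ring

/-- The character `e_p(x) = e^{2πi p·x}` as an element of `C^∞(𝕋ⁿ)`. -/
def character (p : Fin n → ℤ) : SmoothFn n :=
  ⟨UnitAddTorus.mFourier p, by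
    change ContDiff ℝ ∞ fun x : Fin n → ℝ => UnitAddTorus.mFourier p (proj x)
    simp_rw [mFourier_proj, dotProduct]
    exact (contDiff_const.mul (Complex.ofRealCLM.contDiff.comp
      (f := fun x : Fin n → ℝ => ∑ i, freq p i * x i) (by fun_prop))).cexp⟩

lemma norm_character (p : Fin n → ℤ) (X : Torus n) : ‖(character p).1 X‖ = 1 := by
  obtain ⟨x, rfl⟩ := (isOpenQuotientMap_proj n).surjective X
  change ‖UnitAddTorus.mFourier p (proj x)‖ = 1
  rw [mFourier_proj, mul_comm, Complex.norm_exp_ofReal_mul_I]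

lemma character_add (p : Fin n → ℤ) (X : Torus n) (w : Fin n → ℝ) :
    (character p).1 (X + proj w) =
      (character p).1 X * Complex.exp (Complex.I * (freq p ⬝ᵥ w : ℝ)) := by
  obtain ⟨x, rfl⟩ := (isOpenQuotientMap_proj n).surjective X
  change UnitAddTorus.mFourier p (proj x + proj w) = UnitAddTorus.mFourier p (proj x) * _
  rw [← proj_add, mFourier_proj, mFourier_proj, ← Complex.exp_add, dotProduct_add]
  rw [Complex.ofReal_add, mul_add]

lemma hasDerivAt_exp_I_mul (c : ℝ) :
    HasDerivAt (fun s : ℝ => Complex.exp (Complex.I * (s * c : ℝ))) (Complex.I * c) 0 := by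
  have h1 : HasDerivAt (fun s : ℝ => Complex.I * ((s * c : ℝ) : ℂ)) (Complex.I * c) 0 := by
    simpa using (((hasDerivAt_id (0 : ℝ)).mul_const c).ofReal_comp).const_mul Complex.I
  simpa using h1.cexp

lemma hasDerivAt_character (p : Fin n → ℤ) (X : Torus n) (w : Fin n → ℝ) :
    HasDerivAt (fun s : ℝ => (character p).1 (X + proj (s • w)))
      (Complex.I * (freq p ⬝ᵥ w : ℝ) * (character p).1 X) 0 := by
  simp_rw [character_add, dotProduct_smul, smul_eq_mul]
  refine ((hasDerivAt_exp_I_mul (freq p ⬝ᵥ w)).const_mul ((character p).1 X)).congr_deriv ?_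
  ring

/-- The Hilbert basis of `L²(𝕋ⁿ)` formed by the characters. -/
def fourierBasis (n : ℕ) : HilbertBasis (Fin n → ℤ) ℂ (L2 n) := UnitAddTorus.mFourierBasis

lemma fourierBasis_apply (p : Fin n → ℤ) : fourierBasis n p = toL2 (character p) := by
  change UnitAddTorus.mFourierBasis p = _
  rw [UnitAddTorus.coe_mFourierBasis]
  rfl

/-- The Fourier coefficient `⟨e_p, f⟩`. -/
def coeff (p : Fin n → ℤ) (f : L2 n) : ℂ := ⟪fourierBasis n p, f⟫_ℂ

lemma coeff_basis (p q : Fin n → ℤ) : coeff p (fourierBasis n q) = if p = q then 1 else 0 :=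
  orthonormal_iff_ite.1 (fourierBasis n).orthonormal p q

/-- A vector of `L²(𝕋ⁿ)` is determined by its Fourier coefficients. -/
lemma ext_coeff {f g : L2 n} (h : ∀ p, coeff p f = coeff p g) : f = g := by
  apply (fourierBasis n).repr.injective
  ext p
  simpa [coeff, HilbertBasis.repr_apply_apply] using h p

/-- The matrix entry `⟨e_p, T e_q⟩`. -/
def entry (T : L2 n →L[ℂ] L2 n) (p q : Fin n → ℤ) : ℂ := coeff p (T (fourierBasis n q))

lemma hasSum_coeff (p : Fin n → ℤ) (T : L2 n →L[ℂ] L2 n) (f : L2 n) :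
    HasSum (fun q => entry T p q * coeff q f) (coeff p (T f)) := by
  have h := (fourierBasis n).hasSum_inner_mul_inner (T.adjoint (fourierBasis n p)) f
  simp only [ContinuousLinearMap.adjoint_inner_left] at h
  exact h

lemma coeff_toLp (p : Fin n → ℤ) (f : C(Torus n, ℂ)) :
    coeff p (ContinuousMap.toLp 2 (torusMeasure n) ℂ f) =
      ∫ X, (starRingEnd ℂ) ((character p).1 X) * f X ∂torusMeasure n := by
  rw [coeff, fourierBasis_apply, toL2, ContinuousMap.inner_toLp]
  simp [mul_comm]

/-- On the Fourier side `w · hD` is multiplication by `h (w · 2πp)`. -/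
lemma coeff_hD (h : ℝ) (w : Fin n → ℝ) (p : Fin n → ℤ) (φ : SmoothFn n) :
    coeff p (toL2 (hD h w φ)) = ((h * (w ⬝ᵥ freq p) : ℝ) : ℂ) * coeff p (toL2 φ) := by
  set e := (character p).1 with he
  set ψ := hD h w φ with hψ
  have hc1 : Continuous e := continuous_smoothFn (character p)
  have hc2 := continuous_smoothFn φ
  have hc3 := continuous_smoothFn ψ
  have hcF : Continuous fun X => -Complex.I * h * ((starRingEnd ℂ) (e X) * φ.1 X) := by fun_prop
  have hcF' : Continuous fun X => (starRingEnd ℂ) (e X) * ψ.1 X -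
      ((h * (w ⬝ᵥ freq p) : ℝ) : ℂ) * ((starRingEnd ℂ) (e X) * φ.1 X) := by fun_prop
  -- the derivative of `conj e_p * φ` along `w`, multiplied by `-ih`
  have key := integral_eq_zero_of_flow (μ := torusMeasure n)
    (τ := fun t X => X + proj (t • w))
    (fun t => measurePreserving_add_right _ _) (fun X => by simp [proj_zero])
    (fun s t X => by rw [add_smul, proj_add]; abel)
    (F := fun X => -Complex.I * h * ((starRingEnd ℂ) (e X) * φ.1 X))
    (F' := fun X => (starRingEnd ℂ) (e X) * ψ.1 X -
      ((h * (w ⬝ᵥ freq p) : ℝ) : ℂ) * ((starRingEnd ℂ) (e X) * φ.1 X))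
    (hcF.aestronglyMeasurable) (hcF'.aestronglyMeasurable)
    (ContinuousMap.norm_coe_le_norm ⟨_, hcF⟩) (ContinuousMap.norm_coe_le_norm ⟨_, hcF'⟩) ?_
  · have hcpt : ∀ f : Torus n → ℂ, Continuous f → Integrable f (torusMeasure n) := fun f hf =>
      hf.integrable_of_hasCompactSupport (HasCompactSupport.of_compactSpace f)
    rw [integral_sub (hcpt _ (by fun_prop)) (hcpt _ (by fun_prop)), integral_const_mul,
      sub_eq_zero] at key
    rw [toL2, toL2, coeff_toLp, coeff_toLp]
    exact key
  · intro X
    obtain ⟨x, rfl⟩ := (isOpenQuotientMap_proj n).surjective X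
    have h1 := dirDeriv_proj w φ x
    rw [← h1.deriv, ← dirDeriv] at h1
    have h2 := (hasDerivAt_character p (proj x) w).star
    have h3 := (h2.mul h1).const_mul (-Complex.I * (h : ℂ))
    refine h3.congr_deriv ?_
    have h4 : ψ.1 (proj x) = -Complex.I * h * dirDeriv w φ.1 (proj x) := rfl
    rw [h4]
    simp only [he, RCLike.star_def, map_mul, Complex.conj_I, Complex.conj_ofReal,
      dotProduct_comm w, zero_smul, proj_zero, add_zero]
    push_cast
    linear_combination (h : ℂ) * (freq p ⬝ᵥ w : ℝ) *
      (starRingEnd ℂ) ((character p).1 (proj x)) * φ.1 (proj x) * Complex.I_mul_I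

/-- The symbol `∏ⱼ (vⱼ · η)^{βⱼ}` of `𝐁^β` for `h = 1`. -/
def charSymbol (v : Fin d → Fin n → ℝ) (β : Fin d → ℕ) (η : Fin n → ℝ) : ℝ :=
  ∏ j, (v j ⬝ᵥ η) ^ β j

/-- Operators that act as a scalar on the `p`-th Fourier coefficient may be multiplied in any
order, so that no commutation relation between the `B_j` is needed. -/
lemma coeff_prod_ofFn {p : Fin n → ℤ} : ∀ {d : ℕ} {T : Fin d → Module.End ℂ (SmoothFn n)}
    {c : Fin d → ℂ}, (∀ j φ, coeff p (toL2 (T j φ)) = c j * coeff p (toL2 φ)) →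
    ∀ φ, coeff p (toL2 ((List.ofFn T).prod φ)) = (∏ j, c j) * coeff p (toL2 φ)
  | 0, _, _, _, φ => by simp
  | d + 1, T, c, h, φ => by
    rw [List.ofFn_succ, List.prod_cons, Fin.prod_univ_succ, Module.End.mul_apply, h,
      coeff_prod_ofFn fun j => h j.succ]
    ring

lemma coeff_charMonomial (v : Fin d → Fin n → ℝ) (h : ℝ) (β : Fin d → ℕ) (p : Fin n → ℤ)
    (φ : SmoothFn n) :
    coeff p (toL2 (charMonomial v h β φ)) =
      ((h ^ (∑ j, β j) * charSymbol v β (freq p) : ℝ) : ℂ) * coeff p (toL2 φ) := by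
  have h1 : ∀ (k : ℕ) (w : Fin n → ℝ) (φ : SmoothFn n), coeff p (toL2 ((hD h w ^ k) φ)) =
      (((h * (w ⬝ᵥ freq p)) ^ k : ℝ) : ℂ) * coeff p (toL2 φ) := by
    intro k w
    induction k with
    | zero => simp
    | succ k ih =>
      intro φ
      rw [pow_succ', Module.End.mul_apply, coeff_hD, ih]
      push_cast
      ring
  rw [charMonomial, coeff_prod_ofFn (c := fun j => (((h * (v j ⬝ᵥ freq p)) ^ β j : ℝ) : ℂ))
    fun j => h1 (β j) (v j), charSymbol, ← Finset.prod_pow_eq_pow_sum, ← Finset.prod_mul_distrib]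
  push_cast
  simp only [mul_pow]

lemma toL2_charMonomial_character (v : Fin d → Fin n → ℝ) (h : ℝ) (β : Fin d → ℕ)
    (p : Fin n → ℤ) :
    toL2 (charMonomial v h β (character p)) =
      ((h ^ (∑ j, β j) * charSymbol v β (freq p) : ℝ) : ℂ) • fourierBasis n p := by
  refine ext_coeff fun q => ?_
  rw [coeff_charMonomial, ← fourierBasis_apply, coeff, coeff, inner_smul_right]
  change _ * coeff q (fourierBasis n p) = _ * coeff q (fourierBasis n p)
  rw [coeff_basis]
  split_ifs with hq
  · rw [hq]
  · simp

lemma isWeakCharMonomial_iff (v : Fin d → Fin n → ℝ) (h : ℝ) (β : Fin d → ℕ) (f g : L2 n) :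
    IsWeakCharMonomial v h β f g ↔ ∀ p,
      coeff p g = ((h ^ (∑ j, β j) * charSymbol v β (freq p) : ℝ) : ℂ) * coeff p f := by
  constructor
  · intro H p
    have := H (character p)
    rw [toL2_charMonomial_character, inner_smul_left, ← fourierBasis_apply,
      Complex.conj_ofReal] at this
    exact this
  · intro H ψ
    rw [← (fourierBasis n).tsum_inner_mul_inner (toL2 ψ) g,
      ← (fourierBasis n).tsum_inner_mul_inner (toL2 (charMonomial v h β ψ)) f]
    refine tsum_congr fun p => ?_
    have h1 := coeff_charMonomial v h β p ψ
    have h2 := H p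
    simp only [coeff] at h1 h2
    rw [h2, ← inner_conj_symm (toL2 (charMonomial v h β ψ)), h1, map_mul, Complex.conj_ofReal,
      inner_conj_symm]
    ring

/-! ### Residual families as infinite matrices -/

/-- The matrices `M h`, for all small `h`, represent bounded operators on `L²(𝕋ⁿ)` in the Fourier
basis, with norm `O(h^{-l})`. -/
def MatrixBigO (l : ℝ) (M : HParam → (Fin n → ℤ) → (Fin n → ℤ) → ℂ) : Prop :=
  ∃ C h₀ : ℝ, 0 < h₀ ∧ ∀ h : HParam, (h : ℝ) < h₀ → ∃ W : L2 n →L[ℂ] L2 n,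
    (∀ p q, entry W p q = M h p q) ∧ (h : ℝ) ^ l * ‖W‖ ≤ C

lemma entry_smul (c : ℂ) (T : L2 n →L[ℂ] L2 n) (p q : Fin n → ℤ) :
    entry (c • T) p q = c * entry T p q := by
  simp [entry, coeff, inner_smul_right]

lemma entry_add (S T : L2 n →L[ℂ] L2 n) (p q : Fin n → ℤ) :
    entry (S + T) p q = entry S p q + entry T p q := by
  simp [entry, coeff, inner_add_right]

lemma hasSum_entry_mul (S T : L2 n →L[ℂ] L2 n) (p q : Fin n → ℤ) :
    HasSum (fun s => entry S p s * entry T s q) (entry (S * T) p q) :=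
  hasSum_coeff p S (T (fourierBasis n q))

/-- On the Fourier side, `R ∈ ℜ^l` means that all matrices `P^β R_{pq} Q^γ` (with powers of the
components of the frequencies along the `vⱼ`) are `O(h^{-l})`. -/
theorem mem_residual_iff (v : Fin d → Fin n → ℝ) (l : ℝ) (R : OpFamily n) :
    R ∈ Residual v l ↔ ∀ β γ : Fin d → ℕ, MatrixBigO l fun h p q =>
      ((charSymbol v β (freq p) * charSymbol v γ (freq q) : ℝ) : ℂ) * entry (R h) p q := by
  have hpow : ∀ (h : HParam) (β γ : Fin d → ℕ) (x : ℝ),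
      (h : ℝ) ^ (-((∑ j, (β j + γ j) : ℕ) : ℝ) + l) * ((h : ℝ) ^ (∑ j, (β j + γ j)) * x) =
        (h : ℝ) ^ l * x := by
    intro h β γ x
    rw [← mul_assoc, ← Real.rpow_natCast, ← Real.rpow_add h.2.1]
    congr 2
    ring
  refine forall_congr' fun β => forall_congr' fun γ => exists_congr fun C =>
    exists_congr fun h₀ => and_congr_right fun _ => forall_congr' fun h =>
    imp_congr_right fun _ => ?_
  have h0 : (0 : ℝ) < h := h.2.1
  have hk : (0 : ℝ) < (h : ℝ) ^ (∑ j, (β j + γ j)) := by positivity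
  constructor
  · rintro ⟨T, hT, hC⟩
    refine ⟨((((h : ℝ) ^ (∑ j, (β j + γ j)))⁻¹ : ℝ) : ℂ) • T, fun p q => ?_, ?_⟩
    · have h1 := (isWeakCharMonomial_iff _ _ _ _ _).1 (hT (character q)) p
      rw [toL2_charMonomial_character, ← fourierBasis_apply, map_smul] at h1
      rw [entry_smul, entry, h1, coeff, inner_smul_right]
      change _ = _ * coeff p _
      rw [← coeff]
      have : ((h : ℝ) : ℂ) ≠ 0 := by exact_mod_cast h0.ne'
      push_cast
      rw [Finset.sum_add_distrib, pow_add]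
      field_simp
    · rw [norm_smul, Complex.norm_real, Real.norm_of_nonneg (by positivity), ← hpow h β γ,
        mul_inv_cancel_left₀ hk.ne']
      exact hC
  · rintro ⟨W, hW, hC⟩
    refine ⟨(((h : ℝ) ^ (∑ j, (β j + γ j)) : ℝ) : ℂ) • W, fun φ => ?_, ?_⟩
    · refine (isWeakCharMonomial_iff _ _ _ _ _).2 fun p => ?_
      have h1 := hasSum_coeff p ((((h : ℝ) ^ (∑ j, (β j + γ j)) : ℝ) : ℂ) • W) (toL2 φ)
      have h2 := (hasSum_coeff p (R h) (toL2 (charMonomial v h γ φ))).mul_left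
        (((h : ℝ) ^ (∑ j, β j) * charSymbol v β (freq p) : ℝ) : ℂ)
      refine h1.unique (h2.congr_fun fun q => ?_)
      rw [coeff_charMonomial, entry_smul, hW, Finset.sum_add_distrib, pow_add]
      push_cast
      ring
    · rw [norm_smul, Complex.norm_real, Real.norm_of_nonneg hk.le, hpow]
      exact hC

/-! ### Schur's test -/

/-- A matrix supported on the `k`-th diagonal with bounded entries defines a bounded operator. -/
lemma exists_operator_of_diagonal (k : Fin n → ℤ) (m : (Fin n → ℤ) → ℂ) {c : ℝ} (hc : 0 ≤ c)
    (hm : ∀ p, ‖m p‖ ≤ c) :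
    ∃ U : L2 n →L[ℂ] L2 n, ‖U‖ ≤ c ∧ ∀ p q, entry U p q = if q = p - k then m p else 0 := by
  have hp : 0 < (2 : ENNReal).toReal := by norm_num
  have hs : ∀ f : lp (fun _ : Fin n → ℤ => ℂ) 2,
      Summable fun p => c ^ (2 : ENNReal).toReal * ‖f (p - k)‖ ^ (2 : ENNReal).toReal := fun f =>
    ((Equiv.subRight k).summable_iff.2 ((memℓp_gen_iff hp).1 f.2)).mul_left _
  have hle : ∀ (f : lp (fun _ : Fin n → ℤ => ℂ) 2) p, ‖m p * f (p - k)‖ ^ (2 : ENNReal).toReal ≤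
      c ^ (2 : ENNReal).toReal * ‖f (p - k)‖ ^ (2 : ENNReal).toReal := fun f p => by
    rw [norm_mul, Real.mul_rpow (norm_nonneg _) (norm_nonneg _)]
    gcongr
    exact hm p
  have hmem : ∀ f : lp (fun _ : Fin n → ℤ => ℂ) 2, Memℓp (fun p => m p * f (p - k)) 2 := fun f =>
    memℓp_gen (Summable.of_nonneg_of_le (fun p => by positivity) (hle f) (hs f))
  let D : lp (fun _ : Fin n → ℤ => ℂ) 2 →L[ℂ] lp (fun _ : Fin n → ℤ => ℂ) 2 :=
    LinearMap.mkContinuous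
      { toFun := fun f => ⟨fun p => m p * f (p - k), hmem f⟩
        map_add' := fun f g => by ext p; exact mul_add _ _ _
        map_smul' := fun a f => by ext p; exact mul_left_comm _ _ _ } c (fun f => by
      refine (Real.rpow_le_rpow_iff (norm_nonneg _) (by positivity) hp).1 ?_
      rw [Real.mul_rpow hc (norm_nonneg _), lp.norm_rpow_eq_tsum hp, lp.norm_rpow_eq_tsum hp,
        ← tsum_mul_left, ← (Equiv.subRight k).tsum_eq fun p => c ^ _ * ‖f p‖ ^ _]
      exact Summable.tsum_le_tsum (hle f) ((memℓp_gen_iff hp).1 (hmem f)) (hs f))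
  let b := fourierBasis n
  refine ⟨(b.repr.symm.toContinuousLinearEquiv : _ →L[ℂ] L2 n) ∘L D ∘L
    (b.repr.toContinuousLinearEquiv : L2 n →L[ℂ] _), ?_, fun p q => ?_⟩
  · refine ContinuousLinearMap.opNorm_le_bound _ hc fun f => ?_
    change ‖b.repr.symm (D (b.repr f))‖ ≤ _
    rw [LinearIsometryEquiv.norm_map, ← b.repr.norm_map f]
    exact LinearMap.mkContinuous_norm_le _ hc _ |> D.le_of_opNorm_le <| _
  · change ⟪b p, b.repr.symm (D (b.repr (b q)))⟫_ℂ = _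
    rw [← b.repr_apply_apply, LinearIsometryEquiv.apply_symm_apply]
    change m p * (b.repr (b q)) (p - k) = _
    have h1 : (b.repr (b q)) (p - k) = if p - k = q then 1 else 0 := by
      rw [b.repr_apply_apply]
      exact coeff_basis _ _
    rw [h1]
    simp [eq_comm]

/-- **Schur's test** for matrices dominated by a summable function of `p - q`: the operator is
the norm convergent sum of its diagonals. -/
theorem exists_operator_of_entry_le {M : (Fin n → ℤ) → (Fin n → ℤ) → ℂ} {κ : (Fin n → ℤ) → ℝ}
    (hκ : Summable κ) (hM : ∀ p q, ‖M p q‖ ≤ κ (p - q)) :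
    ∃ W : L2 n →L[ℂ] L2 n, (∀ p q, entry W p q = M p q) ∧ ‖W‖ ≤ ∑' k, κ k := by
  have hκ0 : ∀ k, 0 ≤ κ k := fun k => (norm_nonneg _).trans (by simpa using hM k 0)
  choose U hU hUe using fun k => exists_operator_of_diagonal k (fun p => M p (p - k)) (hκ0 k)
    fun p => by simpa using hM p (p - k)
  have hsum : Summable U := Summable.of_norm_bounded hκ hU
  refine ⟨∑' k, U k, fun p q => ?_, tsum_of_norm_bounded hκ.hasSum hU⟩
  have h1 : HasSum (fun k => entry (U k) p q) (entry (∑' k, U k) p q) :=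
    hsum.hasSum.map (AddMonoidHom.mk' (fun T : L2 n →L[ℂ] L2 n => entry T p q)
      fun S T => entry_add S T p q) (by
        change Continuous fun T : L2 n →L[ℂ] L2 n => ⟪fourierBasis n p, T (fourierBasis n q)⟫_ℂ
        fun_prop)
  refine h1.unique ?_
  convert hasSum_ite_eq (p - q) (M p q) using 2 with k
  rw [hUe]
  have : q = p - k ↔ k = p - q := by
    constructor <;> (rintro rfl; abel)
  by_cases h : k = p - q
  · rw [if_pos (this.2 h), if_pos h, ← this.2 h]
  · rw [if_neg (this.not.2 h), if_neg h]

lemma freq_sub (p q : Fin n → ℤ) : freq (p - q) = freq p - freq q := by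
  ext i; simp [freq]; ring

lemma norm_le_norm_freq (p : Fin n → ℤ) : ‖p‖ ≤ ‖freq p‖ := by
  refine (pi_norm_le_iff_of_nonneg (norm_nonneg _)).2 fun i => ?_
  refine le_trans ?_ (norm_le_pi_norm (freq p) i)
  rw [freq, norm_mul, Real.norm_of_nonneg (by positivity), Int.norm_eq_abs]
  have := Real.two_le_pi
  nlinarith [norm_nonneg (p i : ℝ), Real.norm_eq_abs (p i : ℝ)]

lemma summable_freq_decay (n : ℕ) :
    Summable fun p : Fin n → ℤ => (1 + ‖freq p‖) ^ (-((n : ℝ) + 1)) := by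
  have h1 : Summable fun p : Fin n → ℤ => ‖p‖ ^ (-((n : ℝ) + 1)) := by
    -- compare with the sum over the lattice `ℤⁿ ⊆ ℝⁿ`
    let L := Submodule.span ℤ (Set.range (Pi.basisFun ℝ (Fin n)))
    have hr : Module.finrank ℤ L ≤ n := by
      simpa [Set.finrank] using finrank_range_le_card (R := ℤ) (b := Pi.basisFun ℝ (Fin n))
    have hmem : ∀ p : Fin n → ℤ, (fun i => (p i : ℝ)) ∈ L := fun p =>
      (Pi.basisFun ℝ (Fin n)).mem_span_iff_repr_mem ℤ _ |>.2 fun i => ⟨p i, by simp⟩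
    refine ((ZLattice.summable_norm_rpow L (-((n : ℝ) + 1)) ?_).comp_injective
      (i := fun p : Fin n → ℤ => (⟨fun i => (p i : ℝ), hmem p⟩ : L)) ?_).congr fun p => ?_
    · have : (Module.finrank ℤ L : ℝ) ≤ n := by exact_mod_cast hr
      linarith
    · intro p q hpq
      ext i
      simpa using congrFun (congrArg Subtype.val hpq) i
    · change ‖fun i => (p i : ℝ)‖ ^ _ = _
      congr 1
  have hn : (0 : ℝ) ≤ n := Nat.cast_nonneg n
  -- the extra summand covers `p = 0`, where `‖p‖ ^ (-(n + 1))` has the value `0`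
  refine Summable.of_nonneg_of_le (fun p => by positivity) (fun p => ?_)
    (h1.add (hasSum_ite_eq (0 : Fin n → ℤ) (1 : ℝ)).summable)
  split_ifs with hp
  · rw [hp]
    have : (1 + ‖freq (0 : Fin n → ℤ)‖) ^ (-((n : ℝ) + 1)) ≤ 1 :=
      Real.rpow_le_one_of_one_le_of_nonpos (by simp) (by linarith)
    have : (0 : ℝ) ≤ ‖(0 : Fin n → ℤ)‖ ^ (-((n : ℝ) + 1)) := by positivity
    linarith
  · rw [add_zero]
    refine Real.rpow_le_rpow_of_nonpos (norm_pos_iff.2 hp) ?_ (by linarith)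
    linarith [norm_le_norm_freq p]

/-- Off-diagonal decay of order `n + 1` suffices for boundedness on `L²`. -/
theorem MatrixBigO.of_decay {l C : ℝ} {M : HParam → (Fin n → ℤ) → (Fin n → ℤ) → ℂ}
    (hM : ∀ h p q, ‖M h p q‖ ≤
      C * (h : ℝ) ^ (-l) * (1 + ‖freq p - freq q‖) ^ (-((n : ℝ) + 1))) : MatrixBigO l M := by
  refine ⟨C * ∑' p : Fin n → ℤ, (1 + ‖freq p‖) ^ (-((n : ℝ) + 1)), 1, one_pos, fun h _ => ?_⟩
  obtain ⟨W, hW, hb⟩ := exists_operator_of_entry_le (M := M h)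
    ((summable_freq_decay n).mul_left (C * (h : ℝ) ^ (-l))) fun p q => by
      rw [freq_sub]; exact hM h p q
  refine ⟨W, hW, ?_⟩
  have h0 : (0 : ℝ) < (h : ℝ) ^ l := Real.rpow_pos_of_pos h.2.1 _
  rw [tsum_mul_left, Real.rpow_neg h.2.1.le] at hb
  calc (h : ℝ) ^ l * ‖W‖ ≤ (h : ℝ) ^ l * (C * ((h : ℝ) ^ l)⁻¹ * _) := by gcongr
    _ = _ := by field_simp

/-! ### Calculus of matrix bounds -/

lemma MatrixBigO.congr {l : ℝ} {M M' : HParam → (Fin n → ℤ) → (Fin n → ℤ) → ℂ}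
    (hM : MatrixBigO l M) (h : ∀ h p q, M h p q = M' h p q) : MatrixBigO l M' := by
  have : M = M' := by ext; apply h
  rwa [← this]

lemma MatrixBigO.zero (l : ℝ) : MatrixBigO l fun _ (_ _ : Fin n → ℤ) => 0 :=
  ⟨0, 1, one_pos, fun h _ => ⟨0, fun p q => by simp [entry, coeff], by simp⟩⟩

lemma MatrixBigO.add {l : ℝ} {M M' : HParam → (Fin n → ℤ) → (Fin n → ℤ) → ℂ}
    (hM : MatrixBigO l M) (hM' : MatrixBigO l M') :
    MatrixBigO l fun h p q => M h p q + M' h p q := by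
  obtain ⟨C, a, ha, H⟩ := hM
  obtain ⟨C', a', ha', H'⟩ := hM'
  refine ⟨C + C', min a a', lt_min ha ha', fun h hh => ?_⟩
  obtain ⟨W, hW, hC⟩ := H h (hh.trans_le (min_le_left _ _))
  obtain ⟨W', hW', hC'⟩ := H' h (hh.trans_le (min_le_right _ _))
  refine ⟨W + W', fun p q => by rw [entry_add, hW, hW'], ?_⟩
  have h0 : (0 : ℝ) < (h : ℝ) ^ l := Real.rpow_pos_of_pos h.2.1 _
  calc (h : ℝ) ^ l * ‖W + W'‖ ≤ (h : ℝ) ^ l * (‖W‖ + ‖W'‖) := by gcongr; exact norm_add_le _ _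
    _ ≤ C + C' := by linarith

lemma MatrixBigO.const_mul {l : ℝ} {M : HParam → (Fin n → ℤ) → (Fin n → ℤ) → ℂ} (c : ℂ)
    (hM : MatrixBigO l M) : MatrixBigO l fun h p q => c * M h p q := by
  obtain ⟨C, a, ha, H⟩ := hM
  refine ⟨‖c‖ * C, a, ha, fun h hh => ?_⟩
  obtain ⟨W, hW, hC⟩ := H h hh
  refine ⟨c • W, fun p q => by rw [entry_smul, hW], ?_⟩
  rw [norm_smul, mul_left_comm]
  gcongr

lemma MatrixBigO.sum {ι : Type*} {l : ℝ} (s : Finset ι)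
    {M : ι → HParam → (Fin n → ℤ) → (Fin n → ℤ) → ℂ} (hM : ∀ i ∈ s, MatrixBigO l (M i)) :
    MatrixBigO l fun h p q => ∑ i ∈ s, M i h p q := by
  classical
  induction s using Finset.induction_on with
  | empty => simpa using MatrixBigO.zero l
  | insert i s hi ih =>
    simp_rw [Finset.sum_insert hi]
    exact (hM i (Finset.mem_insert_self _ _)).add
      (ih fun j hj => hM j (Finset.mem_insert_of_mem hj))

lemma MatrixBigO.mono {l l' : ℝ} {M : HParam → (Fin n → ℤ) → (Fin n → ℤ) → ℂ}
    (hM : MatrixBigO l M) (hl : l ≤ l') : MatrixBigO l' M := by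
  obtain ⟨C, a, ha, H⟩ := hM
  refine ⟨C, a, ha, fun h hh => ?_⟩
  obtain ⟨W, hW, hC⟩ := H h hh
  refine ⟨W, hW, le_trans ?_ hC⟩
  exact mul_le_mul_of_nonneg_right (Real.rpow_le_rpow_of_exponent_ge h.2.1 h.2.2.le hl)
    (norm_nonneg _)

/-- `N` is a product of infinite matrices; convergence of the sums is part of the hypothesis. -/
lemma MatrixBigO.mul {l l' : ℝ} {M M' N : HParam → (Fin n → ℤ) → (Fin n → ℤ) → ℂ}
    (hM : MatrixBigO l M) (hM' : MatrixBigO l' M')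
    (hN : ∀ h p q, HasSum (fun s => M h p s * M' h s q) (N h p q)) : MatrixBigO (l + l') N := by
  obtain ⟨C, a, ha, H⟩ := hM
  obtain ⟨C', a', ha', H'⟩ := hM'
  refine ⟨C * C', min a a', lt_min ha ha', fun h hh => ?_⟩
  obtain ⟨W, hW, hC⟩ := H h (hh.trans_le (min_le_left _ _))
  obtain ⟨W', hW', hC'⟩ := H' h (hh.trans_le (min_le_right _ _))
  refine ⟨W * W', fun p q => (hasSum_entry_mul W W' p q).unique ?_, ?_⟩
  · simpa only [hW, hW'] using hN h p q
  · have h0 : (0 : ℝ) < (h : ℝ) ^ l := Real.rpow_pos_of_pos h.2.1 _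
    have h0' : (0 : ℝ) < (h : ℝ) ^ l' := Real.rpow_pos_of_pos h.2.1 _
    calc (h : ℝ) ^ (l + l') * ‖W * W'‖ ≤ ((h : ℝ) ^ l * (h : ℝ) ^ l') * (‖W‖ * ‖W'‖) := by
          rw [Real.rpow_add h.2.1]; gcongr; exact norm_mul_le _ _
      _ = ((h : ℝ) ^ l * ‖W‖) * ((h : ℝ) ^ l' * ‖W'‖) := by ring
      _ ≤ C * C' := mul_le_mul hC hC' (by positivity) (le_trans (by positivity) hC)

/-! ### Oscillatory integrals over `𝕋ⁿ × 𝕋ⁿ` -/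

/-- The product measure on `𝕋ⁿ × 𝕋ⁿ`. -/
abbrev torusMeasure₂ (n : ℕ) : Measure (Torus n × Torus n) :=
  (torusMeasure n).prod (torusMeasure n)

/-- Away from the discontinuities of `rep`, small translations of the torus lift to translations
of the representative. -/
lemma rep_add_proj {Z : Torus n} (hZ : ∀ i, ‖Z i‖ < 1 / 2) :
    ∀ᶠ s in 𝓝 (0 : Fin n → ℝ), rep (Z + proj s) = rep Z + s := by
  have hi : ∀ i, ∀ᶠ s in 𝓝 (0 : Fin n → ℝ), rep (Z + proj s) i = rep Z i + s i := by
    intro i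
    have hmem : rep Z i ∈ Set.Ico (-(1 / 2) : ℝ) (-(1 / 2) + 1) :=
      (AddCircle.equivIco (1 : ℝ) (-(1 / 2)) (Z i)).2
    have hcoe : ((rep Z i : ℝ) : UnitAddCircle) = Z i := AddCircle.coe_equivIco
    have hne : rep Z i ≠ -(1 / 2) := by
      intro h
      have := hZ i
      rw [← hcoe, h, AddCircle.norm_eq] at this
      norm_num at this
    have hlt : rep Z i + (0 : Fin n → ℝ) i ∈ Set.Ioo (-(1 / 2) : ℝ) (-(1 / 2) + 1) := by
      rw [Pi.zero_apply, add_zero]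
      exact ⟨lt_of_le_of_ne hmem.1 (Ne.symm hne), hmem.2⟩
    have hc : Continuous fun s : Fin n → ℝ => rep Z i + s i := by fun_prop
    filter_upwards [hc.continuousAt.eventually (isOpen_Ioo.mem_nhds hlt)] with s hs
    have h1 : (Z + proj s) i = ((rep Z i + s i : ℝ) : UnitAddCircle) := by
      rw [AddCircle.coe_add, hcoe]; rfl
    rw [rep, h1, AddCircle.equivIco_coe_eq (Set.Ioo_subset_Ico_self hs)]
  filter_upwards [eventually_all.2 hi] with s hs
  exact funext hs

lemma measurable_rep (i : Fin n) : Measurable fun Z : Torus n => rep Z i :=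
  measurable_subtype_coe.comp ((AddCircle.measurableEquivIco (1 : ℝ) (-(1 / 2))).measurable.comp
    (measurable_pi_apply i))

/-- The oscillating factor `conj e_p(X) e_q(Y) e^{i (X-Y)·ζ}`, with `X - Y` represented in
`[-1/2, 1/2)ⁿ`. -/
def phase (p q : Fin n → ℤ) (ζ : Fin n → ℝ) (Z : Torus n × Torus n) : ℂ :=
  (starRingEnd ℂ) ((character p).1 Z.1) * (character q).1 Z.2 *
    Complex.exp (Complex.I * (rep (Z.1 - Z.2) ⬝ᵥ ζ : ℝ))

lemma norm_phase (p q : Fin n → ℤ) (ζ : Fin n → ℝ) (Z : Torus n × Torus n) :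
    ‖phase p q ζ Z‖ = 1 := by
  rw [phase, norm_mul, norm_mul, RCLike.norm_conj, norm_character, norm_character,
    mul_comm Complex.I, Complex.norm_exp_ofReal_mul_I]
  norm_num

lemma measurable_phase (p q : Fin n → ℤ) :
    Measurable fun x : (Torus n × Torus n) × (Fin n → ℝ) => phase p q x.2 x.1 := by
  have h1 := (continuous_smoothFn (character p)).measurable
  have h2 := (continuous_smoothFn (character q)).measurable
  have h3 : Measurable fun x : (Torus n × Torus n) × (Fin n → ℝ) =>
      rep (x.1.1 - x.1.2) ⬝ᵥ x.2 := by
    unfold dotProduct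
    refine Finset.measurable_sum _ fun i _ => ?_
    refine Measurable.mul ((measurable_rep i).comp ?_) ((measurable_pi_apply i).comp measurable_snd)
    exact (continuous_fst.sub continuous_snd).measurable.comp measurable_fst
  unfold phase
  refine Measurable.mul (Measurable.mul ?_ ?_) ?_
  · exact Complex.continuous_conj.measurable.comp (h1.comp (measurable_fst.comp measurable_fst))
  · exact h2.comp (measurable_snd.comp measurable_fst)
  · exact Complex.continuous_exp.measurable.comp
      (measurable_const.mul (Complex.continuous_ofReal.measurable.comp h3))

/-- The derivative of the phase function in the direction `(u, u')`, divided by `i`. -/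
def phaseRate (p q : Fin n → ℤ) (ζ u u' : Fin n → ℝ) : ℝ :=
  (ζ - freq p) ⬝ᵥ u - (ζ - freq q) ⬝ᵥ u'

lemma hasDerivAt_phase (p q : Fin n → ℤ) (ζ u u' : Fin n → ℝ) {Z : Torus n × Torus n}
    (hZ : ∀ i, ‖Z.1 i - Z.2 i‖ < 1 / 2) :
    HasDerivAt (fun s : ℝ => phase p q ζ (Z.1 + proj (s • u), Z.2 + proj (s • u')))
      (Complex.I * phaseRate p q ζ u u' * phase p q ζ Z) 0 := by
  have hc : Continuous fun s : ℝ => s • (u - u') := by fun_prop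
  have h1 : ∀ᶠ s : ℝ in 𝓝 0, rep (Z.1 - Z.2 + proj (s • (u - u'))) =
      rep (Z.1 - Z.2) + s • (u - u') :=
    (hc.tendsto' 0 0 (by simp)).eventually (rep_add_proj (Z := Z.1 - Z.2) hZ)
  refine (((hasDerivAt_exp_I_mul (phaseRate p q ζ u u')).const_mul
    (phase p q ζ Z)).congr_of_eventuallyEq ?_).congr_deriv (by ring)
  filter_upwards [h1] with s hs
  have h2 : Z.1 + proj (s • u) - (Z.2 + proj (s • u')) = Z.1 - Z.2 + proj (s • (u - u')) := by
    have h3 : proj (s • u) = proj (s • (u - u')) + proj (s • u') := by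
      rw [← proj_add]; congr 1; module
    rw [h3]; abel
  have h4 : (rep (Z.1 - Z.2) + s • (u - u')) ⬝ᵥ ζ =
      rep (Z.1 - Z.2) ⬝ᵥ ζ + s * ((u - u') ⬝ᵥ ζ) := by
    rw [add_dotProduct, smul_dotProduct, smul_eq_mul]
  simp only [phase, phaseRate, h2, hs, h4, character_add, map_mul, ← Complex.exp_conj,
    Complex.conj_I, Complex.conj_ofReal, dotProduct_smul, smul_eq_mul]
  rw [show ∀ a b c d e : ℂ, a * b * (c * d) * e = a * c * (b * d * e) from fun _ _ _ _ _ => by ring,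
    ← Complex.exp_add, ← Complex.exp_add, mul_assoc, mul_assoc, mul_assoc, ← Complex.exp_add]
  congr 3
  simp only [sub_dotProduct, dotProduct_comm u, dotProduct_comm u']
  push_cast
  ring

/-! ### Amplitudes supported near the diagonal -/

/-- Functions `c(X, Y, w)`, smooth in all variables, that vanish when `(X, Y)` is outside the
support of the cutoff. The parameter `w` ranges over a vector space. -/
structure IsAmplitude {W : Type*} [NormedAddCommGroup W] [NormedSpace ℝ W] (χ : Cutoff n)
    (c : Torus n → Torus n → W → ℂ) : Prop where
  smooth : ContDiff ℝ ∞ fun x : (Fin n → ℝ) × (Fin n → ℝ) × W => c (proj x.1) (proj x.2.1) x.2.2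
  support : ∀ X Y w, (X, Y) ∉ tsupport (Function.uncurry χ.toFun) → c X Y w = 0

/-- The derivative of an amplitude in the direction `(u, u')` of `𝕋ⁿ × 𝕋ⁿ`. -/
def ampDeriv {W : Type*} (u u' : Fin n → ℝ) (c : Torus n → Torus n → W → ℂ)
    (X Y : Torus n) (w : W) : ℂ :=
  deriv (fun t : ℝ => c (X + proj (t • u)) (Y + proj (t • u')) w) 0

section Amplitude

variable {W : Type*} [NormedAddCommGroup W] [NormedSpace ℝ W] {χ : Cutoff n}
  {c : Torus n → Torus n → W → ℂ}

lemma IsAmplitude.continuous (hc : IsAmplitude χ c) :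
    Continuous fun x : Torus n × Torus n × W => c x.1 x.2.1 x.2.2 :=
  ((isOpenQuotientMap_proj n).prodMap
    ((isOpenQuotientMap_proj n).prodMap IsOpenQuotientMap.id)).isQuotientMap.continuous_iff.2
    hc.smooth.continuous

lemma IsAmplitude.hasDerivAt_proj (hc : IsAmplitude χ c) (u u' x y : Fin n → ℝ) (w : W) :
    HasDerivAt (fun t : ℝ => c (proj x + proj (t • u)) (proj y + proj (t • u')) w)
      (fderiv ℝ (fun x : (Fin n → ℝ) × (Fin n → ℝ) × W => c (proj x.1) (proj x.2.1) x.2.2)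
        (x, y, w) (u, u', 0)) 0 := by
  have h1 : HasDerivAt (fun t : ℝ => ((x, y, w) : (Fin n → ℝ) × (Fin n → ℝ) × W) +
      t • (u, u', 0)) (u, u', 0) 0 := by
    simpa using ((hasDerivAt_id (0 : ℝ)).smul_const
      ((u, u', 0) : (Fin n → ℝ) × (Fin n → ℝ) × W)).const_add (x, y, w)
  have h2 := ((hc.smooth.differentiable (by simp)) ((x, y, w) +
    (0 : ℝ) • (u, u', 0))).hasFDerivAt.comp_hasDerivAt (0 : ℝ) h1
  simp only [zero_smul, add_zero] at h2
  refine h2.congr_of_eventuallyEq (Eventually.of_forall fun t => ?_)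
  simp [proj_add]

lemma IsAmplitude.hasDerivAt (hc : IsAmplitude χ c) (u u' : Fin n → ℝ) (X Y : Torus n) (w : W) :
    HasDerivAt (fun t : ℝ => c (X + proj (t • u)) (Y + proj (t • u')) w)
      (ampDeriv u u' c X Y w) 0 := by
  obtain ⟨x, rfl⟩ := (isOpenQuotientMap_proj n).surjective X
  obtain ⟨y, rfl⟩ := (isOpenQuotientMap_proj n).surjective Y
  exact (hc.hasDerivAt_proj u u' x y w).differentiableAt.hasDerivAt

lemma continuous_flow (u u' : Fin n → ℝ) (X Y : Torus n) :
    Continuous fun t : ℝ => (X + proj (t • u), Y + proj (t • u')) := by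
  have h := (isOpenQuotientMap_proj n).continuous
  exact (continuous_const.add (h.comp (by fun_prop))).prodMk
    (continuous_const.add (h.comp (by fun_prop)))

lemma eventually_notMem_tsupport (u u' : Fin n → ℝ) {X Y : Torus n}
    (h : (X, Y) ∉ tsupport (Function.uncurry χ.toFun)) :
    ∀ᶠ t : ℝ in 𝓝 0,
      (X + proj (t • u), Y + proj (t • u')) ∉ tsupport (Function.uncurry χ.toFun) :=
  ((continuous_flow u u' X Y).tendsto' 0 (X, Y) (by simp [proj_zero])).eventually
    ((isClosed_tsupport _).isOpen_compl.mem_nhds h)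

lemma IsAmplitude.isAmplitude_ampDeriv (hc : IsAmplitude χ c) (u u' : Fin n → ℝ) :
    IsAmplitude χ (ampDeriv u u' c) where
  smooth := by
    have : (fun x : (Fin n → ℝ) × (Fin n → ℝ) × W =>
        ampDeriv u u' c (proj x.1) (proj x.2.1) x.2.2) = fun z =>
        fderiv ℝ (fun x : (Fin n → ℝ) × (Fin n → ℝ) × W => c (proj x.1) (proj x.2.1) x.2.2)
          z (u, u', 0) := by
      funext z
      exact (hc.hasDerivAt_proj u u' z.1 z.2.1 z.2.2).deriv
    rw [this]
    exact (hc.smooth.fderiv_right (m := ∞) (by simp)).clm_apply contDiff_const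
  support := by
    intro X Y w h
    have h1 : (fun t : ℝ => c (X + proj (t • u)) (Y + proj (t • u')) w) =ᶠ[𝓝 0] fun _ => 0 := by
      filter_upwards [eventually_notMem_tsupport u u' h] with t ht
      exact hc.support _ _ _ ht
    rw [ampDeriv, h1.deriv_eq, deriv_const]

lemma IsAmplitude.exists_bound (hc : IsAmplitude χ c) {K : Set W} (hK : IsCompact K) :
    ∃ C, ∀ w ∈ K, ∀ X Y, ‖c X Y w‖ ≤ C := by
  obtain ⟨C, hC⟩ := ((isCompact_univ (X := Torus n)).prod
    ((isCompact_univ (X := Torus n)).prod hK)).exists_bound_of_continuousOn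
    hc.continuous.continuousOn
  exact ⟨C, fun w hw X Y => hC (X, Y, w) ⟨trivial, trivial, hw⟩⟩

/-- The integral of `conj e_p(X) e_q(Y) e^{i (X-Y)·ζ} f(X,Y)` over `𝕋ⁿ × 𝕋ⁿ`. -/
def oscIntegral (p q : Fin n → ℤ) (ζ : Fin n → ℝ) (f : Torus n → Torus n → ℂ) : ℂ :=
  ∫ Z, phase p q ζ Z * f Z.1 Z.2 ∂torusMeasure₂ n

lemma norm_oscIntegral_le (p q : Fin n → ℤ) (ζ : Fin n → ℝ) {f : Torus n → Torus n → ℂ} {C : ℝ}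
    (hf : ∀ X Y, ‖f X Y‖ ≤ C) : ‖oscIntegral p q ζ f‖ ≤ C := by
  have := norm_integral_le_of_norm_le_const (μ := torusMeasure₂ n)
    (f := fun Z => phase p q ζ Z * f Z.1 Z.2) (C := C)
    (Eventually.of_forall fun Z => by rw [norm_mul, norm_phase, one_mul]; exact hf _ _)
  simpa [oscIntegral] using this

lemma IsAmplitude.aestronglyMeasurable_phase_mul (hc : IsAmplitude χ c) (p q : Fin n → ℤ)
    (ζ : Fin n → ℝ) (w : W) :
    AEStronglyMeasurable (fun Z : Torus n × Torus n => phase p q ζ Z * c Z.1 Z.2 w)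
      (torusMeasure₂ n) := by
  have h1 : Continuous fun Z : Torus n × Torus n => c Z.1 Z.2 w :=
    hc.continuous.comp (continuous_fst.prodMk (continuous_snd.prodMk continuous_const))
  have h2 : Measurable (phase p q ζ) :=
    Measurable.comp (f := fun Z => (Z, ζ)) (measurable_phase p q) measurable_prodMk_right
  exact h2.aestronglyMeasurable.mul h1.aestronglyMeasurable

lemma IsAmplitude.exists_bound_phase_mul (hc : IsAmplitude χ c) (p q : Fin n → ℤ)
    (ζ : Fin n → ℝ) (w : W) :
    ∃ C, ∀ Z : Torus n × Torus n, ‖phase p q ζ Z * c Z.1 Z.2 w‖ ≤ C := by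
  obtain ⟨C, hC⟩ := hc.exists_bound (isCompact_singleton (x := w))
  refine ⟨C, fun Z => ?_⟩
  rw [norm_mul, norm_phase, one_mul]
  exact hC w (Set.mem_singleton w) _ _

/-- Integration by parts along the translation flow in direction `(u, u')`. The phase is
differentiable on the support of the amplitude, which stays away from the discontinuity of
`rep`. -/
lemma oscIntegral_ampDeriv (hc : IsAmplitude χ c) (p q : Fin n → ℤ) (ζ u u' : Fin n → ℝ) (w : W) :
    oscIntegral p q ζ (fun X Y => ampDeriv u u' c X Y w) =
      -(Complex.I * phaseRate p q ζ u u') * oscIntegral p q ζ (fun X Y => c X Y w) := by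
  have hc' := hc.isAmplitude_ampDeriv u u'
  have hm := hc.aestronglyMeasurable_phase_mul p q ζ w
  have hm' := hc'.aestronglyMeasurable_phase_mul p q ζ w
  obtain ⟨C, hC⟩ := hc.exists_bound_phase_mul p q ζ w
  obtain ⟨C', hC'⟩ := hc'.exists_bound_phase_mul p q ζ w
  have hi := Integrable.of_bound hm C (Eventually.of_forall hC)
  have hi' := Integrable.of_bound hm' C' (Eventually.of_forall hC')
  have key := integral_eq_zero_of_flow (μ := torusMeasure₂ n)
    (τ := fun t Z => (Z.1 + proj (t • u), Z.2 + proj (t • u')))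
    (fun t => (measurePreserving_add_right _ _).prod (measurePreserving_add_right _ _))
    (fun Z => by simp [proj_zero])
    (fun s t Z => by simp only [add_smul, proj_add]; congr 1 <;> abel)
    (F := fun Z => phase p q ζ Z * c Z.1 Z.2 w)
    (F' := fun Z => Complex.I * phaseRate p q ζ u u' * (phase p q ζ Z * c Z.1 Z.2 w) +
      phase p q ζ Z * ampDeriv u u' c Z.1 Z.2 w)
    hm ((hm.const_mul _).add hm')
    (C' := ‖Complex.I * phaseRate p q ζ u u'‖ * C + C') hC (fun Z => ?_) (fun Z => ?_)
  · rw [integral_add (hi.const_mul _) hi', integral_const_mul] at key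
    unfold oscIntegral
    linear_combination key
  · refine (norm_add_le _ _).trans (add_le_add ?_ (hC' Z))
    rw [norm_mul]
    exact mul_le_mul_of_nonneg_left (hC Z) (norm_nonneg _)
  · by_cases hZ : Z ∈ tsupport (Function.uncurry χ.toFun)
    · refine ((hasDerivAt_phase p q ζ u u' (χ.support Z hZ)).mul
        (hc.hasDerivAt u u' Z.1 Z.2 w)).congr_deriv ?_
      simp only [zero_smul, proj_zero, add_zero]
      ring
    · rw [hc.support _ _ _ hZ, hc'.support _ _ _ hZ, mul_zero, mul_zero, add_zero]
      refine (hasDerivAt_const (0 : ℝ) (0 : ℂ)).congr_of_eventuallyEq ?_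
      filter_upwards [eventually_notMem_tsupport u u' hZ] with t ht
      rw [hc.support _ _ _ ht, mul_zero]

lemma IsAmplitude.iterate (hc : IsAmplitude χ c) (u u' : Fin n → ℝ) (N : ℕ) :
    IsAmplitude χ ((ampDeriv u u')^[N] c) := by
  induction N with
  | zero => exact hc
  | succ N ih => rw [Function.iterate_succ_apply']; exact ih.isAmplitude_ampDeriv u u'

lemma norm_oscIntegral_iterate (hc : IsAmplitude χ c) (p q : Fin n → ℤ) (ζ u u' : Fin n → ℝ)
    (w : W) (N : ℕ) :
    ‖oscIntegral p q ζ (fun X Y => (ampDeriv u u')^[N] c X Y w)‖ =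
      |phaseRate p q ζ u u'| ^ N * ‖oscIntegral p q ζ (fun X Y => c X Y w)‖ := by
  induction N with
  | zero => simp
  | succ N ih =>
    rw [Function.iterate_succ_apply', oscIntegral_ampDeriv (hc.iterate u u' N), norm_mul, ih,
      norm_neg, norm_mul, Complex.norm_I, Complex.norm_real, Real.norm_eq_abs]
    ring

/-- Repeated integration by parts in the directions `(eⱼ, 0)` and `(eᵢ, eᵢ)` gives decay in
`ζ - 2πp` and in `2πp - 2πq`, uniformly for parameters in a compact set. -/
theorem IsAmplitude.oscIntegral_decay (hc : IsAmplitude χ c) {K : Set W} (hK : IsCompact K)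
    (s : ℝ) : ∃ C, 0 ≤ C ∧ ∀ w ∈ K, ∀ (ζ : Fin n → ℝ) (p q : Fin n → ℤ),
      ‖oscIntegral p q ζ (fun X Y => c X Y w)‖ ≤
        C * (1 + ‖freq p - freq q‖) ^ (-s) * (1 + ‖ζ - freq p‖) ^ (-s) := by
  set N := ⌈s⌉₊ with hN
  -- `A i` and `B i` differentiate `N` times in the direction `(eᵢ, eᵢ)` and `(eᵢ, 0)`. The index
  -- `none` stands for no differentiation; it serves the vectors of norm at most `1`.
  let A : Option (Fin n) → (Torus n → Torus n → W → ℂ) → Torus n → Torus n → W → ℂ := fun i c =>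
    i.elim c fun i => (ampDeriv (Pi.single i 1) (Pi.single i 1))^[N] c
  let B : Option (Fin n) → (Torus n → Torus n → W → ℂ) → Torus n → Torus n → W → ℂ := fun i c =>
    i.elim c fun i => (ampDeriv (Pi.single i 1) 0)^[N] c
  let x : (Fin n → ℝ) → Option (Fin n) → ℝ := fun ζ i => i.elim 1 ζ
  have hA : ∀ i {c}, IsAmplitude χ c → IsAmplitude χ (A i c) := by
    rintro (_ | i) c hc
    exacts [hc, hc.iterate _ _ _]
  have hB : ∀ i {c}, IsAmplitude χ c → IsAmplitude χ (B i c) := by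
    rintro (_ | i) c hc
    exacts [hc, hc.iterate _ _ _]
  have hAn : ∀ i {c} (hc : IsAmplitude χ c) (p q : Fin n → ℤ) ζ w,
      ‖oscIntegral p q ζ (fun X Y => A i c X Y w)‖ = |x (freq p - freq q) i| ^ N *
        ‖oscIntegral p q ζ (fun X Y => c X Y w)‖ := by
    rintro (_ | i) c hc p q ζ w
    · simp [A, x]
    · refine (norm_oscIntegral_iterate hc p q ζ _ _ w N).trans ?_
      simp only [phaseRate, dotProduct_single_one, Pi.sub_apply, x, Option.elim]
      rw [abs_sub_comm (freq p i)]
      congr 3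
      ring
  have hBn : ∀ i {c} (hc : IsAmplitude χ c) (p q : Fin n → ℤ) ζ w,
      ‖oscIntegral p q ζ (fun X Y => B i c X Y w)‖ = |x (ζ - freq p) i| ^ N *
        ‖oscIntegral p q ζ (fun X Y => c X Y w)‖ := by
    rintro (_ | i) c hc p q ζ w
    · simp [B, x]
    · refine (norm_oscIntegral_iterate hc p q ζ _ _ w N).trans ?_
      simp [phaseRate, x]
  -- a factor `(1 + ‖ζ‖) ^ s` is controlled by a power of the largest component of `ζ`
  have hx : ∀ ζ : Fin n → ℝ, ∃ i, (1 + ‖ζ‖) ^ s ≤ 2 ^ N * |x ζ i| ^ N := by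
    intro ζ
    have h1 : (1 + ‖ζ‖) ^ s ≤ (1 + ‖ζ‖) ^ N := by
      rw [← Real.rpow_natCast]
      exact Real.rpow_le_rpow_of_exponent_le (by linarith [norm_nonneg ζ]) (Nat.le_ceil s)
    suffices ∃ i, 1 + ‖ζ‖ ≤ 2 * |x ζ i| by
      obtain ⟨i, hi⟩ := this
      refine ⟨i, h1.trans ?_⟩
      rw [← mul_pow]
      gcongr
    rcases le_or_gt ‖ζ‖ 1 with h | h
    · exact ⟨none, by simp only [x, Option.elim, abs_one]; linarith⟩
    · by_contra! H
      have h2 : ‖ζ‖ ≤ (1 + ‖ζ‖) / 2 := (pi_norm_le_iff_of_nonneg (by positivity)).2 fun i => by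
        have := H (some i)
        simp only [x, Option.elim, ← Real.norm_eq_abs] at this
        linarith
      linarith
  choose C hC using fun ij : Option (Fin n) × Option (Fin n) =>
    (hA ij.1 (hB ij.2 hc)).exists_bound hK
  refine ⟨2 ^ N * 2 ^ N * ∑ ij, |C ij|, by positivity, fun w hw ζ p q => ?_⟩
  obtain ⟨i, hi⟩ := hx (freq p - freq q)
  obtain ⟨j, hj⟩ := hx (ζ - freq p)
  have h1 := norm_oscIntegral_le p q ζ (hC (i, j) w hw)
  rw [hAn i (hB j hc), hBn j hc] at h1
  have h2 : C (i, j) ≤ ∑ ij, |C ij| := (le_abs_self _).trans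
    (Finset.single_le_sum (f := fun ij => |C ij|) (fun _ _ => abs_nonneg _)
      (Finset.mem_univ (i, j)))
  have hpos : ∀ ζ : Fin n → ℝ, 0 < (1 + ‖ζ‖) ^ s := fun ζ =>
    Real.rpow_pos_of_pos (by linarith [norm_nonneg ζ]) _
  rw [Real.rpow_neg (by positivity), Real.rpow_neg (by positivity), ← div_eq_mul_inv,
    ← div_eq_mul_inv, le_div_iff₀ (hpos _), le_div_iff₀ (hpos _)]
  set J := ‖oscIntegral p q ζ (fun X Y => c X Y w)‖
  calc J * (1 + ‖ζ - freq p‖) ^ s * (1 + ‖freq p - freq q‖) ^ s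
      ≤ J * (2 ^ N * |x (ζ - freq p) j| ^ N) * (2 ^ N * |x (freq p - freq q) i| ^ N) := by
        gcongr
    _ = 2 ^ N * 2 ^ N * (|x (freq p - freq q) i| ^ N * (|x (ζ - freq p) j| ^ N * J)) := by ring
    _ ≤ 2 ^ N * 2 ^ N * ∑ ij, |C ij| := by gcongr; exact h1.trans h2

end Amplitude

/-! ### The weight `⟨v · η⟩` -/

lemma one_le_radius (v : Fin d → Fin n → ℝ) (η : Fin n → ℝ) : 1 ≤ radius v η 1 := by
  refine Real.one_le_sqrt.2 ?_
  have : 0 ≤ ∑ j, (v j ⬝ᵥ η) ^ 2 := by positivity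
  linarith

lemma radius_one_pos (v : Fin d → Fin n → ℝ) (η : Fin n → ℝ) : 0 < radius v η 1 :=
  one_pos.trans_le (one_le_radius v η)

lemma sq_radius (v : Fin d → Fin n → ℝ) (ξ : Fin n → ℝ) (h : ℝ) :
    radius v ξ h ^ 2 = ∑ j, (v j ⬝ᵥ ξ) ^ 2 + h ^ 2 :=
  Real.sq_sqrt (by positivity)

lemma radius_eq_mul (v : Fin d → Fin n → ℝ) (ξ : Fin n → ℝ) {h : ℝ} (hh : 0 < h) :
    radius v ξ h = h * radius v (h⁻¹ • ξ) 1 := by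
  have h1 : 0 ≤ radius v ξ h := Real.sqrt_nonneg _
  have h2 : 0 ≤ radius v (h⁻¹ • ξ) 1 := Real.sqrt_nonneg _
  rw [← sq_eq_sq₀ h1 (mul_nonneg hh.le h2), mul_pow, sq_radius, sq_radius, mul_add, Finset.mul_sum]
  congr 1
  · refine Finset.sum_congr rfl fun j _ => ?_
    rw [dotProduct_smul, smul_eq_mul]
    field_simp
  · ring

lemma abs_charSymbol_le (v : Fin d → Fin n → ℝ) (β : Fin d → ℕ) (η : Fin n → ℝ) :
    |charSymbol v β η| ≤ radius v η 1 ^ (∑ j, β j) := by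
  rw [charSymbol, Finset.abs_prod, ← Finset.prod_pow_eq_pow_sum]
  refine Finset.prod_le_prod (fun j _ => abs_nonneg _) fun j _ => ?_
  rw [abs_pow]
  gcongr
  refine Real.abs_le_sqrt ?_
  have := Finset.single_le_sum (f := fun j => (v j ⬝ᵥ η) ^ 2) (fun j _ => sq_nonneg _)
    (Finset.mem_univ j)
  linarith

/-- Peetre's inequality: the weight grows at most linearly under translation. -/
lemma exists_radius_le (v : Fin d → Fin n → ℝ) :
    ∃ C, 0 < C ∧ ∀ η ζ, radius v η 1 ≤ C * (1 + ‖η - ζ‖) * radius v ζ 1 := by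
  set A : ℝ := ∑ j, (∑ i, |v j i|) ^ 2 with hA
  have hA0 : 0 ≤ A := by positivity
  refine ⟨√(2 * (1 + A)), by positivity, fun η ζ => ?_⟩
  refine abs_le_of_sq_le_sq' ?_ (by have := radius_one_pos v ζ; positivity) |>.2
  have h1 : ∀ j, (v j ⬝ᵥ η) ^ 2 ≤
      2 * (v j ⬝ᵥ ζ) ^ 2 + 2 * ((∑ i, |v j i|) ^ 2 * ‖η - ζ‖ ^ 2) := by
    intro j
    have h2 : |v j ⬝ᵥ (η - ζ)| ≤ (∑ i, |v j i|) * ‖η - ζ‖ := by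
      rw [dotProduct, Finset.sum_mul]
      refine (Finset.abs_sum_le_sum_abs _ _).trans (Finset.sum_le_sum fun i _ => ?_)
      rw [abs_mul]
      gcongr
      exact norm_le_pi_norm (η - ζ) i
    have h3 : (v j ⬝ᵥ (η - ζ)) ^ 2 ≤ (∑ i, |v j i|) ^ 2 * ‖η - ζ‖ ^ 2 := by
      rw [← mul_pow, ← sq_abs]
      gcongr
    have h4 : v j ⬝ᵥ η = v j ⬝ᵥ ζ + v j ⬝ᵥ (η - ζ) := by rw [← dotProduct_add]; simp
    rw [h4]
    nlinarith [sq_nonneg (v j ⬝ᵥ ζ - v j ⬝ᵥ (η - ζ))]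
  have h2 := Finset.sum_le_sum fun j (_ : j ∈ Finset.univ) => h1 j
  rw [Finset.sum_add_distrib, ← Finset.mul_sum, ← Finset.mul_sum, ← Finset.sum_mul, ← hA] at h2
  rw [mul_pow, mul_pow, Real.sq_sqrt (by positivity), sq_radius, sq_radius]
  set t := ∑ j, (v j ⬝ᵥ ζ) ^ 2
  have ht : 0 ≤ t := by positivity
  have hx := norm_nonneg (η - ζ)
  have h3 : 1 + ‖η - ζ‖ ^ 2 ≤ (1 + ‖η - ζ‖) ^ 2 := by nlinarith
  have h4 : 0 ≤ ‖η - ζ‖ ^ 2 := by positivity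
  calc _ ≤ 2 * t + 2 * (A * ‖η - ζ‖ ^ 2) + 1 ^ 2 := by gcongr
    _ ≤ 2 * (1 + A) * (1 + ‖η - ζ‖ ^ 2) * (t + 1 ^ 2) := by
      have e1 : 0 ≤ A * t := by positivity
      have e2 : 0 ≤ A * ‖η - ζ‖ ^ 2 * t := by positivity
      have e3 : 0 ≤ ‖η - ζ‖ ^ 2 * t := by positivity
      nlinarith
    _ ≤ _ := by gcongr

/-- Peetre's inequality for real powers of the weight. -/
lemma exists_radius_rpow_le (v : Fin d → Fin n → ℝ) (k : ℝ) :
    ∃ C, 0 < C ∧ ∀ η ζ, radius v η 1 ^ k ≤ C * (1 + ‖η - ζ‖) ^ |k| * radius v ζ 1 ^ k := by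
  obtain ⟨C, hC, H⟩ := exists_radius_le v
  refine ⟨C ^ |k|, by positivity, fun η ζ => ?_⟩
  have hη := radius_one_pos v η
  have hζ := radius_one_pos v ζ
  have hx : 0 < 1 + ‖η - ζ‖ := by positivity
  rcases le_total 0 k with hk | hk
  · rw [abs_of_nonneg hk, ← Real.mul_rpow hC.le hx.le, ← Real.mul_rpow (by positivity) hζ.le]
    exact Real.rpow_le_rpow hη.le (H η ζ) hk
  · have h1 := Real.rpow_le_rpow hζ.le (H ζ η) (neg_nonneg.2 hk)
    rw [norm_sub_rev, Real.mul_rpow (by positivity) hη.le, Real.mul_rpow hC.le hx.le,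
      Real.rpow_neg hζ.le, Real.rpow_neg hη.le, ← div_eq_mul_inv, le_div_iff₀ (by positivity),
      inv_mul_le_iff₀ (by positivity)] at h1
    rw [abs_of_nonpos hk]
    linarith

/-- The power `ρ_sf^{-m} ρ_ff^{-l}` of the boundary defining functions in terms of `ξ / h`. -/
lemma boundary_weight_eq (v : Fin d → Fin n → ℝ) (m l : ℝ) (ξ : Fin n → ℝ) {h : ℝ} (hh : 0 < h) :
    (h / radius v ξ h) ^ (-m) * radius v ξ h ^ (-l) =
      h ^ (-l) * radius v (h⁻¹ • ξ) 1 ^ (m - l) := by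
  have hΛ := radius_one_pos v (h⁻¹ • ξ)
  rw [radius_eq_mul v ξ hh, Real.mul_rpow hh.le hΛ.le, div_mul_cancel_left₀ hh.ne',
    Real.inv_rpow hΛ.le, Real.rpow_neg hΛ.le m, inv_inv, sub_eq_add_neg, Real.rpow_add hΛ]
  ring

/-! ### Matrix entries of quantized symbols -/

/-- The matrix entry of a quantization is an integral over `ξ` of oscillatory integrals over
`𝕋ⁿ × 𝕋ⁿ`. -/
lemma entry_integralOp_oscKernel (χ : Cutoff n) {h : ℝ} {s : Torus n × Torus n → (Fin n → ℝ) → ℂ}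
    (hs : Continuous (Function.uncurry s)) {M : ℝ} (hM : ∀ Z ξ, s Z ξ ≠ 0 → ‖ξ‖ ≤ M)
    {K : C(Torus n × Torus n, ℂ)} (hK : ∀ Z, K Z = oscKernel χ h (s Z) Z.1 Z.2)
    (p q : Fin n → ℤ) :
    entry (integralOp K) p q = (((2 * Real.pi * h) ^ n)⁻¹ : ℝ) *
      ∫ ξ, oscIntegral p q (h⁻¹ • ξ) (fun X Y => χ X Y * s (X, Y) ξ) := by
  set a : ℂ := ((((2 * Real.pi * h) ^ n)⁻¹ : ℝ) : ℂ) with ha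
  set Φ : (Torus n × Torus n) × (Fin n → ℝ) → ℂ := fun x =>
    phase p q (h⁻¹ • x.2) x.1 * (χ x.1.1 x.1.2 * s x.1 x.2) with hΦ
  have hΦi : Integrable Φ ((torusMeasure₂ n).prod volume) := by
    have h1 : Continuous fun x : (Torus n × Torus n) × (Fin n → ℝ) =>
        (χ x.1.1 x.1.2 : ℂ) * s x.1 x.2 :=
      (Complex.continuous_ofReal.comp (χ.continuous.comp continuous_fst)).mul hs
    have h2 : HasCompactSupport fun x : (Torus n × Torus n) × (Fin n → ℝ) =>
        (χ x.1.1 x.1.2 : ℂ) * s x.1 x.2 := by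
      refine HasCompactSupport.intro (isCompact_univ.prod (isCompact_closedBall 0 M)) ?_
      intro x hx
      have : s x.1 x.2 = 0 := by
        by_contra hne
        exact hx ⟨trivial, by simpa using hM _ _ hne⟩
      rw [this, mul_zero]
    have h3 : Measurable fun x : (Torus n × Torus n) × (Fin n → ℝ) =>
        phase p q (h⁻¹ • x.2) x.1 :=
      Measurable.comp (f := fun x : (Torus n × Torus n) × (Fin n → ℝ) => (x.1, h⁻¹ • x.2))
        (measurable_phase p q) (by fun_prop)
    exact (h1.integrable_of_hasCompactSupport h2).bdd_mul h3.aestronglyMeasurable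
      (Eventually.of_forall fun x => (norm_phase _ _ _ _).le)
  -- the integrand of the triple integral, before and after expanding the kernel
  have hpt : ∀ X Y, (starRingEnd ℂ) ((character p).1 X) * (K (X, Y) * (character q).1 Y) =
      a * ∫ ξ, Φ ((X, Y), ξ) := by
    intro X Y
    rw [hK, oscKernel, ← ha]
    rw [show ∀ x y z w : ℂ, x * (y * z * w) = y * ((x * w) * z) from fun _ _ _ _ => by ring,
      ← integral_const_mul]
    congr 2
    funext ξ
    simp only [hΦ, phase, dotProduct_smul, smul_eq_mul]
    rw [show Complex.I / (h : ℂ) * ((rep (X - Y) ⬝ᵥ ξ : ℝ) : ℂ) =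
      Complex.I * ((h⁻¹ * (rep (X - Y) ⬝ᵥ ξ) : ℝ) : ℂ) by push_cast; ring]
    ring
  have hq : ∀ X, ∫ Y, K (X, Y) * (fourierBasis n q : L2 n) Y ∂torusMeasure n =
      ∫ Y, K (X, Y) * (character q).1 Y ∂torusMeasure n := by
    intro X
    refine integral_congr_ae ?_
    have : (fourierBasis n q : L2 n) =ᵐ[torusMeasure n] (character q).1 := by
      rw [fourierBasis_apply, toL2]
      exact ContinuousMap.coeFn_toLp _ _
    filter_upwards [this] with Y hY
    rw [hY]
  calc entry (integralOp K) p q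
      = ∫ X, (starRingEnd ℂ) ((character p).1 X) *
          ∫ Y, K (X, Y) * (fourierBasis n q : L2 n) Y ∂torusMeasure n ∂torusMeasure n :=
        coeff_toLp p _
    _ = ∫ X, ∫ Y, a * (∫ ξ, Φ ((X, Y), ξ)) ∂torusMeasure n ∂torusMeasure n := by
        simp_rw [hq, ← integral_const_mul _ (fun Y => K (_, Y) * _), hpt]
    _ = a * ∫ Z, (∫ ξ, Φ (Z, ξ)) ∂torusMeasure₂ n := by
        rw [← integral_const_mul]
        exact (integral_prod (fun Z => a * ∫ ξ, Φ (Z, ξ))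
          (hΦi.integral_prod_left.const_mul a)).symm
    _ = a * ∫ ξ, (∫ Z, Φ (Z, ξ) ∂torusMeasure₂ n) := by
        rw [integral_integral_swap hΦi]

/-- `A` has order `k` along `v` and size `h^{-l}`: its matrix entries decay rapidly off the
diagonal, and grow at most like `h^{-l} ⟨v · 2πp⟩^k` along it. -/
def HasOrder (v : Fin d → Fin n → ℝ) (k l : ℝ) (A : OpFamily n) : Prop :=
  ∀ s : ℝ, ∃ C, 0 ≤ C ∧ ∀ (h : HParam) (p q : Fin n → ℤ), ‖entry (A h) p q‖ ≤
    C * (h : ℝ) ^ (-l) * (1 + ‖freq p - freq q‖) ^ (-s) * radius v (freq p) 1 ^ k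

lemma integrable_decay (n : ℕ) :
    Integrable fun η : Fin n → ℝ => (1 + ‖η‖) ^ (-((n : ℝ) + 1)) :=
  integrable_one_add_norm (by simp)

lemma integrable_decay_smul_sub {h : ℝ} (hh : 0 < h) (η : Fin n → ℝ) :
    Integrable fun ξ : Fin n → ℝ => (1 + ‖h⁻¹ • ξ - η‖) ^ (-((n : ℝ) + 1)) :=
  ((integrable_decay n).comp_sub_right η).comp_smul (inv_ne_zero hh.ne')

lemma integral_decay_smul_sub {h : ℝ} (hh : 0 < h) (η : Fin n → ℝ) :
    ∫ ξ : Fin n → ℝ, (1 + ‖h⁻¹ • ξ - η‖) ^ (-((n : ℝ) + 1)) =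
      h ^ n * ∫ η : Fin n → ℝ, (1 + ‖η‖) ^ (-((n : ℝ) + 1)) := by
  rw [Measure.integral_comp_inv_smul_of_nonneg volume
      (fun ξ : Fin n → ℝ => (1 + ‖ξ - η‖) ^ (-((n : ℝ) + 1))) hh.le,
    integral_sub_right_eq_self (fun ξ : Fin n → ℝ => (1 + ‖ξ‖) ^ (-((n : ℝ) + 1)))]
  simp

/-- The order of a quantization whose symbol is evaluated at the base point `b(X, Y)`. No
derivative of the symbol in `ξ` is used: after the substitution `ξ = hη` its size at `η` is
`h^{-l} ⟨v · η⟩^{m-l}`, and the oscillatory integrals are concentrated near `η = 2πp`. -/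
theorem hasOrder_of_oscKernel {v : Fin d → Fin n → ℝ} {m l : ℝ} (χ : Cutoff n)
    (a : TotalSymbol v m l) {b : Torus n × Torus n → Torus n} (hb : Continuous b)
    (hamp : ∀ G, IsSmoothCompact v G → IsAmplitude χ fun X Y w => χ X Y * G (b (X, Y), w))
    {K : HParam → C(Torus n × Torus n, ℂ)}
    (hK : ∀ h Z, K h Z = oscKernel χ h (fun ξ => a (b Z) ξ h) Z.1 Z.2) :
    HasOrder v (m - l) l fun h => integralOp (K h) := by
  intro s
  set k := m - l with hk
  obtain ⟨G, hG, ha⟩ := a.isSymbol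
  obtain ⟨L, hL, -, hL0⟩ := hG.compact_support
  -- The exponent pays for the requested decay in `P - Q`, for Peetre's inequality (`|k|`) and for
  -- integrability in `ξ` (`n + 1`).
  obtain ⟨C, hC, H⟩ := (hamp G hG).oscIntegral_decay (hL.image continuous_snd)
    (max s (|k| + (n + 1)))
  obtain ⟨C', hC', H'⟩ := exists_radius_rpow_le v k
  set I := ∫ η : Fin n → ℝ, (1 + ‖η‖) ^ (-((n : ℝ) + 1)) with hI
  have hI0 : 0 ≤ I := integral_nonneg fun η => by positivity
  refine ⟨((2 * Real.pi) ^ n)⁻¹ * (C * C' * I), by positivity, fun h p q => ?_⟩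
  have h0 : (0 : ℝ) < h := h.2.1
  set D := (1 + ‖freq p - freq q‖) ^ (-s) with hD
  set Λ := radius v (freq p) 1 ^ k with hΛ
  have hΛ0 : 0 < Λ := Real.rpow_pos_of_pos (radius_one_pos v _) _
  have hD0 : 0 < D := Real.rpow_pos_of_pos (by positivity) _
  have hl0 : 0 < (h : ℝ) ^ (-l) := Real.rpow_pos_of_pos h0 _
  have hpoint : ∀ ξ, ‖oscIntegral p q ((h : ℝ)⁻¹ • ξ) fun X Y => χ X Y * a (b (X, Y)) ξ h‖ ≤
      (C * C' * (h : ℝ) ^ (-l) * D * Λ) *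
        (1 + ‖(h : ℝ)⁻¹ • ξ - freq p‖) ^ (-((n : ℝ) + 1)) := by
    intro ξ
    set ζ := (h : ℝ)⁻¹ • ξ with hζ
    set w : (Fin n → ℝ) × ℝ × (Fin d → ℝ) × ℝ := (ξ, radius v ξ h,
      (fun j => (v j ⬝ᵥ ξ) / radius v ξ h), (h : ℝ) / radius v ξ h) with hw
    have haw : ∀ X, a X ξ h = (((h : ℝ) ^ (-l) * radius v ζ 1 ^ k : ℝ) : ℂ) * G (X, w) := by
      intro X
      rw [ha X ξ h _ _ _ (lift_mem_STot X ξ h) (mul_div_cancel₀ _ (radius_pos ξ h).ne'),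
        boundary_weight_eq v m l ξ h0]
    have hosc : oscIntegral p q ζ (fun X Y => χ X Y * a (b (X, Y)) ξ h) =
        (((h : ℝ) ^ (-l) * radius v ζ 1 ^ k : ℝ) : ℂ) *
          oscIntegral p q ζ fun X Y => χ X Y * G (b (X, Y), w) := by
      rw [oscIntegral, oscIntegral, ← integral_const_mul]
      congr 1
      funext Z
      rw [haw]
      ring
    have hx : (1 : ℝ) ≤ 1 + ‖ζ - freq p‖ := by linarith [norm_nonneg (ζ - freq p)]
    have hrζ : 0 < radius v ζ 1 ^ k := Real.rpow_pos_of_pos (radius_one_pos v _) _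
    have hbound : ‖oscIntegral p q ζ fun X Y => χ X Y * G (b (X, Y), w)‖ ≤
        C * D * (1 + ‖ζ - freq p‖) ^ (-(|k| + ((n : ℝ) + 1))) := by
      -- outside the compact support of `G` in `S_tot` there is nothing to estimate
      by_cases hwL : w ∈ Prod.snd '' L
      · refine (H w hwL ζ p q).trans ?_
        have hy : (1 : ℝ) ≤ 1 + ‖freq p - freq q‖ := by linarith [norm_nonneg (freq p - freq q)]
        exact mul_le_mul (mul_le_mul_of_nonneg_left
            (Real.rpow_le_rpow_of_exponent_le hy (neg_le_neg (le_max_left _ _))) hC)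
          (Real.rpow_le_rpow_of_exponent_le hx (neg_le_neg (le_max_right _ _)))
          (by positivity) (by positivity)
      · have hz : ∀ X, G (X, w) = 0 := fun X =>
          hL0 _ (lift_mem_STot X ξ h) fun hmem => hwL ⟨_, hmem, rfl⟩
        simp only [hz, mul_zero, oscIntegral, integral_zero, norm_zero]
        positivity
    rw [hosc, norm_mul, Complex.norm_real, Real.norm_of_nonneg (by positivity)]
    calc _ ≤ (h : ℝ) ^ (-l) * (C' * (1 + ‖ζ - freq p‖) ^ |k| * Λ) *
          (C * D * (1 + ‖ζ - freq p‖) ^ (-(|k| + ((n : ℝ) + 1)))) := by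
          gcongr
          exact H' ζ (freq p)
      _ = (C * C' * (h : ℝ) ^ (-l) * D * Λ) * ((1 + ‖ζ - freq p‖) ^ |k| *
          (1 + ‖ζ - freq p‖) ^ (-(|k| + ((n : ℝ) + 1)))) := by ring
      _ = _ := by
          rw [← Real.rpow_add (by linarith)]
          congr 2
          ring
  obtain ⟨M, hM⟩ := a.bounded_support h
  rw [entry_integralOp_oscKernel (h := h) (s := fun Z ξ => a (b Z) ξ h) χ
    ((a.continuous h).comp ((hb.comp continuous_fst).prodMk continuous_snd))
    (fun Z ξ => hM _ ξ) (hK h) p q, norm_mul, Complex.norm_real,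
    Real.norm_of_nonneg (by positivity)]
  have hint := norm_integral_le_of_norm_le
    ((integrable_decay_smul_sub h0 (freq p)).const_mul (C * C' * (h : ℝ) ^ (-l) * D * Λ))
    (Eventually.of_forall hpoint)
  rw [integral_const_mul, integral_decay_smul_sub h0, ← hI] at hint
  calc _ ≤ ((2 * Real.pi * (h : ℝ)) ^ n)⁻¹ *
        (C * C' * (h : ℝ) ^ (-l) * D * Λ * ((h : ℝ) ^ n * I)) := by gcongr
    _ = _ := by
      rw [mul_pow]
      field_simp

lemma contDiff_cutoff (χ : Cutoff n) {W : Type*} [NormedAddCommGroup W] [NormedSpace ℝ W] :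
    ContDiff ℝ ∞ fun x : (Fin n → ℝ) × (Fin n → ℝ) × W =>
      ((χ (proj x.1) (proj x.2.1) : ℝ) : ℂ) :=
  Complex.ofRealCLM.contDiff.comp (ContDiff.comp
    (g := fun q : (Fin n → ℝ) × (Fin n → ℝ) => χ (proj q.1) (proj q.2))
    (f := fun x : (Fin n → ℝ) × (Fin n → ℝ) × W => (x.1, x.2.1)) χ.smooth (by fun_prop))

lemma Cutoff.eq_zero (χ : Cutoff n) {X Y : Torus n}
    (h : (X, Y) ∉ tsupport (Function.uncurry χ.toFun)) : χ X Y = 0 :=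
  image_eq_zero_of_notMem_tsupport (f := Function.uncurry χ.toFun) h

/-- The amplitude of a right quantization; the parameter `w = (ξ, r, θ, σ)` ranges over the fibre
coordinates of the ambient space of `S_tot`. -/
lemma isAmplitude_snd {v : Fin d → Fin n → ℝ} (χ : Cutoff n) {G : Ambient n d → ℂ}
    (hG : IsSmoothCompact v G) : IsAmplitude χ fun X Y w => χ X Y * G (Y, w) where
  smooth := (contDiff_cutoff χ).mul (hG.smooth.comp contDiff_snd)
  support X Y w h := by simp [χ.eq_zero h]

/-- The amplitude of a left quantization, with the same parameters. -/
lemma isAmplitude_fst {v : Fin d → Fin n → ℝ} (χ : Cutoff n) {G : Ambient n d → ℂ}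
    (hG : IsSmoothCompact v G) : IsAmplitude χ fun X Y w => χ X Y * G (X, w) where
  smooth := (contDiff_cutoff χ).mul (ContDiff.comp
    (f := fun x : (Fin n → ℝ) × (Fin n → ℝ) × (Fin n → ℝ) × ℝ × (Fin d → ℝ) × ℝ => (x.1, x.2.2))
    hG.smooth (by fun_prop))
  support X Y w h := by simp [χ.eq_zero h]

theorem hasOrder_opR {v : Fin d → Fin n → ℝ} {m l : ℝ} (χ : Cutoff n) (a : TotalSymbol v m l) :
    HasOrder v (m - l) l (opR χ a) :=
  hasOrder_of_oscKernel χ a continuous_snd (fun _ hG => isAmplitude_snd χ hG) fun _ _ => rfl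

theorem hasOrder_opL {v : Fin d → Fin n → ℝ} {m l : ℝ} (χ : Cutoff n) (a : TotalSymbol v m l) :
    HasOrder v (m - l) l (opL χ a) :=
  hasOrder_of_oscKernel χ a continuous_fst (fun _ hG => isAmplitude_fst χ hG) fun _ _ => rfl

/-! ### Products with residual families -/

lemma charSymbol_zero (v : Fin d → Fin n → ℝ) (η : Fin n → ℝ) : charSymbol v 0 η = 1 := by
  simp [charSymbol]

/-- Polynomials in `vⱼ · D` may be applied to residual families from the left. -/
lemma matrixBigO_eval_left {v : Fin d → Fin n → ℝ} {l : ℝ} {R : OpFamily n}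
    (hR : R ∈ Residual v l) (F : MvPolynomial (Fin d) ℝ) (γ : Fin d → ℕ) :
    MatrixBigO l fun h p q => ((MvPolynomial.eval (fun j => v j ⬝ᵥ freq p) F *
      charSymbol v γ (freq q) : ℝ) : ℂ) * entry (R h) p q := by
  refine (MatrixBigO.sum F.support fun β _ => MatrixBigO.const_mul ((F.coeff β : ℝ) : ℂ)
    ((mem_residual_iff v l R).1 hR β γ)).congr fun h p q => ?_
  rw [MvPolynomial.eval_eq']
  simp only [charSymbol]
  push_cast
  rw [Finset.sum_mul, Finset.sum_mul]
  exact Finset.sum_congr rfl fun β _ => by ring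

/-- Polynomials in `vⱼ · D` may be applied to residual families from the right. -/
lemma matrixBigO_eval_right {v : Fin d → Fin n → ℝ} {l : ℝ} {R : OpFamily n}
    (hR : R ∈ Residual v l) (β : Fin d → ℕ) (F : MvPolynomial (Fin d) ℝ) :
    MatrixBigO l fun h p q => ((charSymbol v β (freq p) *
      MvPolynomial.eval (fun j => v j ⬝ᵥ freq q) F : ℝ) : ℂ) * entry (R h) p q := by
  refine (MatrixBigO.sum F.support fun γ _ => MatrixBigO.const_mul ((F.coeff γ : ℝ) : ℂ)
    ((mem_residual_iff v l R).1 hR β γ)).congr fun h p q => ?_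
  rw [MvPolynomial.eval_eq']
  simp only [charSymbol]
  push_cast
  rw [Finset.mul_sum, Finset.sum_mul]
  exact Finset.sum_congr rfl fun β _ => by ring

/-- The polynomial `(1 + ∑ⱼ xⱼ²)^N`, whose value at `xⱼ = vⱼ · η` is `⟨v · η⟩^{2N}`. -/
def weightPoly (d N : ℕ) : MvPolynomial (Fin d) ℝ := (1 + ∑ j, MvPolynomial.X j ^ 2) ^ N

lemma eval_weightPoly (v : Fin d → Fin n → ℝ) (N : ℕ) (η : Fin n → ℝ) :
    MvPolynomial.eval (fun j => v j ⬝ᵥ η) (weightPoly d N) = radius v η 1 ^ (2 * N) := by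
  rw [pow_mul, sq_radius, weightPoly]
  simp [add_comm]

/-- If `|β| + k ≤ 2N`, then `(v · P)^β A Λ^{-2N}` is bounded, where `Λ = ⟨v · D⟩`: Peetre's
inequality moves `Λ^{-2N}` across `A` at the cost of a power of `1 + |P - Q|`. -/
lemma HasOrder.matrixBigO_left {v : Fin d → Fin n → ℝ} {k l : ℝ} {A : OpFamily n}
    (hA : HasOrder v k l A) (β : Fin d → ℕ) {N : ℕ} (hN : (∑ j, β j : ℕ) + k ≤ 2 * N) :
    MatrixBigO l fun h p q =>
      ((charSymbol v β (freq p) * (radius v (freq q) 1 ^ (2 * N))⁻¹ : ℝ) : ℂ) *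
        entry (A h) p q := by
  obtain ⟨C, hC, H⟩ := hA (2 * N + (n + 1))
  obtain ⟨C', hC', H'⟩ := exists_radius_rpow_le v (-(2 * N : ℝ))
  refine MatrixBigO.of_decay (C := C' * C) fun h p q => ?_
  have hp := one_le_radius v (freq p)
  have hp0 := radius_one_pos v (freq p)
  have hq0 := radius_one_pos v (freq q)
  have hx : 0 < 1 + ‖freq p - freq q‖ := by positivity
  have hl0 : 0 < (h : ℝ) ^ (-l) := Real.rpow_pos_of_pos h.2.1 _
  have h1 : (radius v (freq q) 1 ^ (2 * N))⁻¹ ≤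
      C' * (1 + ‖freq p - freq q‖) ^ (2 * N : ℝ) * radius v (freq p) 1 ^ (-(2 * N : ℝ)) := by
    have := H' (freq q) (freq p)
    rw [norm_sub_rev, abs_neg, abs_of_nonneg (by positivity), Real.rpow_neg hq0.le] at this
    exact_mod_cast this
  have h2 : radius v (freq p) 1 ^ (∑ j, β j) * radius v (freq p) 1 ^ (-(2 * N : ℝ)) *
      radius v (freq p) 1 ^ k ≤ 1 := by
    rw [← Real.rpow_natCast, ← Real.rpow_add hp0, ← Real.rpow_add hp0]
    exact Real.rpow_le_one_of_one_le_of_nonpos hp (by linarith)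
  rw [norm_mul, Complex.norm_real, Real.norm_eq_abs, abs_mul,
    abs_of_pos (a := (radius v (freq q) 1 ^ (2 * N))⁻¹) (by positivity)]
  calc _ ≤ radius v (freq p) 1 ^ (∑ j, β j) *
        (C' * (1 + ‖freq p - freq q‖) ^ (2 * N : ℝ) * radius v (freq p) 1 ^ (-(2 * N : ℝ))) *
        (C * (h : ℝ) ^ (-l) * (1 + ‖freq p - freq q‖) ^ (-(2 * N + (n + 1)) : ℝ) *
          radius v (freq p) 1 ^ k) := by
        gcongr
        · exact abs_charSymbol_le v β _
        · exact H h p q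
    _ = C' * C * (h : ℝ) ^ (-l) * ((1 + ‖freq p - freq q‖) ^ (2 * N : ℝ) *
        (1 + ‖freq p - freq q‖) ^ (-(2 * N + (n + 1)) : ℝ)) *
        (radius v (freq p) 1 ^ (∑ j, β j) * radius v (freq p) 1 ^ (-(2 * N : ℝ)) *
          radius v (freq p) 1 ^ k) := by ring
    _ ≤ C' * C * (h : ℝ) ^ (-l) * ((1 + ‖freq p - freq q‖) ^ (2 * N : ℝ) *
        (1 + ‖freq p - freq q‖) ^ (-(2 * N + (n + 1)) : ℝ)) * 1 := by gcongr
    _ = _ := by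
        rw [← Real.rpow_add hx, mul_one]
        congr 2
        ring

/-- If `|γ| + k ≤ 2N`, then `Λ^{-2N} A (v · Q)^γ` is bounded; here `(v · Q)^γ` is moved across. -/
lemma HasOrder.matrixBigO_right {v : Fin d → Fin n → ℝ} {k l : ℝ} {A : OpFamily n}
    (hA : HasOrder v k l A) (γ : Fin d → ℕ) {N : ℕ} (hN : (∑ j, γ j : ℕ) + k ≤ 2 * N) :
    MatrixBigO l fun h p q =>
      (((radius v (freq p) 1 ^ (2 * N))⁻¹ * charSymbol v γ (freq q) : ℝ) : ℂ) *
        entry (A h) p q := by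
  set b : ℝ := ((∑ j, γ j : ℕ) : ℝ) with hb
  have hb0 : 0 ≤ b := Nat.cast_nonneg _
  obtain ⟨C, hC, H⟩ := hA (b + (n + 1))
  obtain ⟨C', hC', H'⟩ := exists_radius_rpow_le v b
  refine MatrixBigO.of_decay (C := C' * C) fun h p q => ?_
  have hp := one_le_radius v (freq p)
  have hp0 := radius_one_pos v (freq p)
  have hx : 0 < 1 + ‖freq p - freq q‖ := by positivity
  have hl0 : 0 < (h : ℝ) ^ (-l) := Real.rpow_pos_of_pos h.2.1 _
  have h1 : |charSymbol v γ (freq q)| ≤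
      C' * (1 + ‖freq p - freq q‖) ^ b * radius v (freq p) 1 ^ b := by
    have := H' (freq q) (freq p)
    rw [norm_sub_rev, abs_of_nonneg hb0] at this
    refine (abs_charSymbol_le v γ _).trans ?_
    rwa [← Real.rpow_natCast]
  have h2 : (radius v (freq p) 1 ^ (2 * N))⁻¹ * radius v (freq p) 1 ^ b *
      radius v (freq p) 1 ^ k ≤ 1 := by
    rw [← Real.rpow_natCast, ← Real.rpow_neg hp0.le, ← Real.rpow_add hp0, ← Real.rpow_add hp0]
    refine Real.rpow_le_one_of_one_le_of_nonpos hp ?_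
    push_cast
    linarith
  rw [norm_mul, Complex.norm_real, Real.norm_eq_abs, abs_mul,
    abs_of_pos (a := (radius v (freq p) 1 ^ (2 * N))⁻¹) (by positivity)]
  calc _ ≤ (radius v (freq p) 1 ^ (2 * N))⁻¹ *
        (C' * (1 + ‖freq p - freq q‖) ^ b * radius v (freq p) 1 ^ b) *
        (C * (h : ℝ) ^ (-l) * (1 + ‖freq p - freq q‖) ^ (-(b + (n + 1))) *
          radius v (freq p) 1 ^ k) := by
        gcongr
        exact H h p q
    _ = C' * C * (h : ℝ) ^ (-l) * ((1 + ‖freq p - freq q‖) ^ b *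
        (1 + ‖freq p - freq q‖) ^ (-(b + (n + 1)))) *
        ((radius v (freq p) 1 ^ (2 * N))⁻¹ * radius v (freq p) 1 ^ b *
          radius v (freq p) 1 ^ k) := by ring
    _ ≤ C' * C * (h : ℝ) ^ (-l) * ((1 + ‖freq p - freq q‖) ^ b *
        (1 + ‖freq p - freq q‖) ^ (-(b + (n + 1)))) * 1 := by gcongr
    _ = _ := by
        rw [← Real.rpow_add hx, mul_one]
        congr 2
        ring

lemma exists_le_two_mul (x : ℝ) : ∃ N : ℕ, x ≤ 2 * N := by
  obtain ⟨N, hN⟩ := exists_nat_ge x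
  exact ⟨N, hN.trans (by linarith [(Nat.cast_nonneg N : (0 : ℝ) ≤ N)])⟩

/-- `(P^β A Λ^{-2N}) (Λ^{2N} R Q^γ)` is a product of bounded families for large `N`, where
`Λ = ⟨v · D⟩`. -/
theorem HasOrder.mul_residual {v : Fin d → Fin n → ℝ} {k l l' : ℝ} {A R : OpFamily n}
    (hA : HasOrder v k l A) (hR : R ∈ Residual v l') : A * R ∈ Residual v (l + l') := by
  refine (mem_residual_iff v _ _).2 fun β γ => ?_
  obtain ⟨N, hN⟩ := exists_le_two_mul ((∑ j, β j : ℕ) + k)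
  refine (hA.matrixBigO_left β hN).mul (matrixBigO_eval_left hR (weightPoly d N) γ)
    fun h p q => ?_
  refine ((hasSum_entry_mul (A h) (R h) p q).mul_left _).congr_fun fun s => ?_
  have hs : ((radius v (freq s) 1 : ℝ) : ℂ) ≠ 0 := by exact_mod_cast (radius_one_pos v _).ne'
  rw [eval_weightPoly]
  push_cast
  field_simp

/-- `(P^β R Λ^{2N}) (Λ^{-2N} A Q^γ)` is a product of bounded families for large `N`, where
`Λ = ⟨v · D⟩`. -/
theorem HasOrder.residual_mul {v : Fin d → Fin n → ℝ} {k l l' : ℝ} {A R : OpFamily n}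
    (hA : HasOrder v k l A) (hR : R ∈ Residual v l') : R * A ∈ Residual v (l + l') := by
  refine (mem_residual_iff v _ _).2 fun β γ => ?_
  obtain ⟨N, hN⟩ := exists_le_two_mul ((∑ j, γ j : ℕ) + k)
  rw [add_comm l]
  refine (matrixBigO_eval_right hR β (weightPoly d N)).mul (hA.matrixBigO_right γ hN)
    fun h p q => ?_
  refine ((hasSum_entry_mul (R h) (A h) p q).mul_left _).congr_fun fun s => ?_
  have hs : ((radius v (freq s) 1 : ℝ) : ℂ) ≠ 0 := by exact_mod_cast (radius_one_pos v _).ne'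
  rw [eval_weightPoly]
  push_cast
  field_simp

theorem mul_mem_residual {v : Fin d → Fin n → ℝ} {l l' : ℝ} {R R' : OpFamily n}
    (hR : R ∈ Residual v l) (hR' : R' ∈ Residual v l') : R * R' ∈ Residual v (l + l') := by
  refine (mem_residual_iff v _ _).2 fun β γ => ?_
  refine ((mem_residual_iff v l R).1 hR β 0).mul ((mem_residual_iff v l' R').1 hR' 0 γ)
    fun h p q => ?_
  refine ((hasSum_entry_mul (R h) (R' h) p q).mul_left _).congr_fun fun s => ?_
  simp only [charSymbol_zero, mul_one, one_mul]
  push_cast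
  ring

lemma residual_mono {v : Fin d → Fin n → ℝ} {l l' : ℝ} (h : l ≤ l') :
    Residual v l ⊆ Residual v l' := fun R hR =>
  (mem_residual_iff v _ _).2 fun β γ => ((mem_residual_iff v l R).1 hR β γ).mono h

lemma zero_mem_residual (v : Fin d → Fin n → ℝ) (l : ℝ) : (0 : OpFamily n) ∈ Residual v l :=
  (mem_residual_iff v _ _).2 fun β γ => (MatrixBigO.zero l).congr fun h p q => by
    simp [entry, coeff]

lemma add_mem_residualAll {v : Fin d → Fin n → ℝ} {R R' : OpFamily n}
    (hR : R ∈ ResidualAll v) (hR' : R' ∈ ResidualAll v) : R + R' ∈ ResidualAll v := by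
  obtain ⟨l, hl⟩ := Set.mem_iUnion.1 hR
  obtain ⟨l', hl'⟩ := Set.mem_iUnion.1 hR'
  replace hl := residual_mono (le_max_left l l') hl
  replace hl' := residual_mono (le_max_right l l') hl'
  refine Set.mem_iUnion.2 ⟨max l l', (mem_residual_iff v _ _).2 fun β γ => ?_⟩
  refine (((mem_residual_iff v _ R).1 hl β γ).add ((mem_residual_iff v _ R').1 hl' β γ)).congr
    fun h p q => ?_
  rw [Pi.add_apply, entry_add, mul_add]

lemma smul_mem_residualAll {v : Fin d → Fin n → ℝ} (c : ℂ) {R : OpFamily n}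
    (hR : R ∈ ResidualAll v) : c • R ∈ ResidualAll v := by
  obtain ⟨l, hl⟩ := Set.mem_iUnion.1 hR
  refine Set.mem_iUnion.2 ⟨l, (mem_residual_iff v _ _).2 fun β γ => ?_⟩
  refine (((mem_residual_iff v _ R).1 hl β γ).const_mul c).congr fun h p q => ?_
  rw [Pi.smul_apply, entry_smul, mul_left_comm]

/-- The zero symbol. -/
def zeroSymbol (v : Fin d → Fin n → ℝ) (m l : ℝ) : TotalSymbol v m l where
  toFun _ _ _ := 0
  isSymbol := ⟨fun _ => 0, ⟨contDiff_const, ∅, isCompact_empty, Set.empty_subset _,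
    fun _ _ _ => rfl⟩, fun _ _ _ _ _ _ _ _ => by simp⟩

lemma opL_zeroSymbol (v : Fin d → Fin n → ℝ) (m l : ℝ) (χ : Cutoff n) :
    opL χ (zeroSymbol v m l) = 0 := by
  have h1 : ∀ h Z, kernelL χ (zeroSymbol v m l) h Z = 0 := fun h Z => by
    simp [kernelL, oscKernel, zeroSymbol]
  funext h
  ext1 u
  change ContinuousMap.toLp 2 (torusMeasure n) ℂ
    ⟨fun X => ∫ Y, kernelL χ (zeroSymbol v m l) h (X, Y) * u Y ∂torusMeasure n, _⟩ = 0
  rw [← map_zero (ContinuousMap.toLp 2 (torusMeasure n) ℂ)]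
  congr 1
  ext X
  simp [h1]

end SecondMicro

end

theorem mainTheorem8 {n d : ℕ} (v : Fin d → Fin n → ℝ) (hv : LinearIndependent ℝ v)
    (χ : SecondMicro.Cutoff n) :
    -- `ℜ` is a linear subspace of `Ψ_{2,h}(𝒞)`, absorbing products from both sides
    ((0 : SecondMicro.OpFamily n) ∈ SecondMicro.ResidualAll v ∧
      (∀ R ∈ SecondMicro.ResidualAll v, ∀ R' ∈ SecondMicro.ResidualAll v,
        R + R' ∈ SecondMicro.ResidualAll v) ∧
      (∀ (c : ℂ), ∀ R ∈ SecondMicro.ResidualAll v, c • R ∈ SecondMicro.ResidualAll v) ∧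
      SecondMicro.ResidualAll v ⊆ SecondMicro.Psi v χ ∧
      (∀ A ∈ SecondMicro.Psi v χ, ∀ R ∈ SecondMicro.ResidualAll v,
        A * R ∈ SecondMicro.ResidualAll v ∧ R * A ∈ SecondMicro.ResidualAll v)) ∧
    (∀ (m l l' : ℝ) (a : SecondMicro.TotalSymbol v m l), ∀ R ∈ SecondMicro.Residual v l',
      SecondMicro.opR χ a * R ∈ SecondMicro.Residual v (l + l') ∧
      R * SecondMicro.opR χ a ∈ SecondMicro.Residual v (l + l')) ∧
    (∀ l l' : ℝ, ∀ R ∈ SecondMicro.Residual v l, ∀ R' ∈ SecondMicro.Residual v l',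
      R * R' ∈ SecondMicro.Residual v (l + l')) := by
  open SecondMicro in
  refine ⟨⟨Set.mem_iUnion.2 ⟨0, zero_mem_residual v 0⟩,
    fun R hR R' hR' => add_mem_residualAll hR hR', fun c R hR => smul_mem_residualAll c hR,
    fun R hR => ⟨R, hR, 0, 0, zeroSymbol v 0 0, by rw [opL_zeroSymbol, add_zero]⟩, ?_⟩,
    fun m l l' a R hR => ⟨(hasOrder_opR χ a).mul_residual hR, (hasOrder_opR χ a).residual_mul hR⟩,
    fun l l' R hR R' hR' => mul_mem_residual hR hR'⟩
  rintro _ ⟨R₀, hR₀, m, l, a, rfl⟩ R hR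
  obtain ⟨l₀, hl₀⟩ := Set.mem_iUnion.1 hR₀
  obtain ⟨l', hl'⟩ := Set.mem_iUnion.1 hR
  rw [add_mul, mul_add]
  exact ⟨add_mem_residualAll (Set.mem_iUnion.2 ⟨_, mul_mem_residual hl₀ hl'⟩)
      (Set.mem_iUnion.2 ⟨_, (hasOrder_opL χ a).mul_residual hl'⟩),
    add_mem_residualAll (Set.mem_iUnion.2 ⟨_, mul_mem_residual hl' hl₀⟩)
      (Set.mem_iUnion.2 ⟨_, (hasOrder_opL χ a).residual_mul hl'⟩)⟩
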